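/- **Theorem 1.2 (Aomoto's equations).** Let $\mathcal G$ be a finite connected undirected graph, loops and multiple edges allowed, with vertex set $V(\mathcal G)$ and edge multiset $E(\mathcal G)$. Let $b_u\in\mathbb R$ ($u\in V(\mathcal G)$) and $a_e\in\mathbb R\setminus\{0\}$ ($e\in E(\mathcal G)$) be coefficients. The Jacobi matrix of a graph with edge coefficients $a$ and vertex coefficients $b$ is the operator on $\ell^2$ of its vertex set given by $$(Af)(u)=b_uf(u)+\sum_{e=\{u,v\},\,v\neq u}a_e f(v)+2\sum_{l=\{u,u\}}a_l f(u).$$ Each edge of $\mathcal G$ gives two directed edges that are exchanged by reversal; a loop at $u$ also gives two distinct directed edges $(u,u)$, each the reversal of the other. Fix a root $v_0\in V(\mathcal G)$. The universal cover $\mathcal T$ of $\mathcal G$ is the tree whose vertices are the walks in $\mathcal G$ from $v_0$ (including the empty walk) in which no directed edge is immediately followed by its reversal; two such walks are joined by an edge if one is obtained from the other by appending a directed edge. The covering map $\phi:\mathcal T\to\mathcal G$ sends a walk to its endpoint, and sends the edge between a walk and its extension by a directed edge $d$ to the edge of $\mathcal G$ underlying $d$. Let $A_{\mathcal T}$ be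 the Jacobi matrix of $\mathcal T$ with the coefficients pulled back along $\phi$; it is a bounded self-adjoint operator on $\ell^2(V(\mathcal T))$, with spectrum $\sigma(A_{\mathcal T})\subset\mathbb R$. For each $u\in V(\mathcal G)$ choose $\tilde u\in\phi^{-1}(u)$, let $\mu_{A_{\mathcal T},\tilde u}$ be the spectral measure of $A_{\mathcal T}$ at $\delta_{\tilde u}$ (the measure on $\mathbb R$ carried by $\sigma(A_{\mathcal T})$ with $\int f\,d\mu_{A_{\mathcal T},\tilde u}=\langle\delta_{\tilde u},f(A_{\mathcal T})\delta_{\tilde u}\rangle$ for continuous $f$), and let $$w_u(z)=\int_{\mathbb R}\frac{1}{z-t}\,d\mu_{A_{\mathcal T},\tilde u}(t)$$ be its Cauchy transform. Then there is a neighborhood of infinity in $\mathbb C$, which does not depend on the chosen $\tilde u$, such that for all $z$ in it, and also for all real $z$ outside the convex hull of $\sigma(A_{\mathcal T})$, $$w_u(z)=\frac{1}{2(z-b_u)}\left(2-\deg(u)+\sum_{\substack{e\in E(\mathcal G)\\ e=\{u,v\},\,v\neq u}}\sqrt{1+4a_e^2\,w_u(z)w_v(z)}+\sum_{\substack{e\in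 E(\mathcal G)\\ e=\{u,u\}}}2\sqrt{1+4a_e^2\,w_u(z)^2}\right)\qquad\text{for all }u\in V(\mathcal G),$$ where each loop at $u$ contributes $2$ to $\deg(u)$ and $\sqrt{\cdot}$ is the principal branch of the square root. -/

import Mathlib

open scoped Graph InnerProductSpace

namespace Graph

variable {α β : Type*}

/-- A multigraph (loops and parallel edges allowed) is connected if it has a vertex and any two of
its vertices are joined by a walk. -/
def IsConnected (G : Graph α β) : Prop :=
  V(G).Nonempty ∧ ∀ x ∈ V(G), ∀ y ∈ V(G), Relation.ReflTransGen G.Adj x y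

/-- The pairs `(e, v)` where `e` is an edge with ends `u` and `v`, and `v ≠ u`. Summing over this
type is summing over the non-loop edges `e = {u, v}` at `u`, with multiplicity. -/
abbrev Spoke (G : Graph α β) (u : α) : Type _ :=
  {p : β × V(G) // G.IsLink p.1 u p.2 ∧ (p.2 : α) ≠ u}

/-- The degree of a vertex; a loop contributes 2. -/
noncomputable def degree (G : Graph α β) (u : α) : ℕ :=
  {e | G.IsNonloopAt e u}.ncard + 2 * (G.loopSet u).ncard

/-! ### Jacobi operators -/

/-- The action of the Jacobi matrix with edge coefficients `a` and vertex coefficients `b` on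
functions on the vertices:
`(A f)(u) = b_u f(u) + ∑_{e = {u,v}, v ≠ u} a_e f(v) + 2 ∑_{l = {u,u}} a_l f(u)`. -/
noncomputable def jacobiFun (G : Graph α β) (a : β → ℝ) (b : α → ℝ) (f : V(G) → ℂ) (u : V(G)) : ℂ :=
  (b u : ℂ) * f u + (∑ᶠ p : G.Spoke u, (a p.1.1 : ℂ) * f p.1.2)
    + 2 * ∑ᶠ l : G.loopSet u, (a l : ℂ) * f u

/-- Uniformly bounded degrees and coefficients; then the Jacobi matrix is a bounded operator. -/
structure IsBoundedJacobi (G : Graph α β) (a : β → ℝ) (b : α → ℝ) : Prop where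
  incidence : ∃ N : ℕ, ∀ u ∈ V(G), (G.incidenceSet u).encard ≤ N
  edge : ∃ C : ℝ, ∀ e ∈ E(G), |a e| ≤ C
  vertex : ∃ C : ℝ, ∀ u ∈ V(G), |b u| ≤ C

section Bounded

variable {G : Graph α β} {a : β → ℝ} {b : α → ℝ}

theorem Spoke.injective_edge (u : α) : Function.Injective (fun p : G.Spoke u => p.1.1) := by
  rintro ⟨⟨e, v⟩, h, hv⟩ ⟨⟨e', v'⟩, h', hv'⟩ (rfl : e = e')
  have : v = v' := Subtype.ext (h.right_unique h')
  subst this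
  rfl

theorem Spoke.encard_le {u : α} {N : ℕ} (h : (G.incidenceSet u).encard ≤ N) :
    Finite (G.Spoke u) ∧ Nat.card (G.Spoke u) ≤ N := by
  have hfin : (G.incidenceSet u).Finite := Set.finite_of_encard_le_coe h
  have : Finite (G.incidenceSet u) := hfin
  let φ : G.Spoke u → G.incidenceSet u := fun p => ⟨p.1.1, ⟨_, p.2.1⟩⟩
  have hφ : Function.Injective φ := fun p q hpq =>
    Spoke.injective_edge u (congrArg Subtype.val hpq)
  refine ⟨Finite.of_injective φ hφ, (Nat.card_le_card_of_injective φ hφ).trans ?_⟩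
  have h1 : Nat.card (G.incidenceSet u) = (G.incidenceSet u).ncard := rfl
  rw [h1]
  have := hfin.cast_ncard_eq
  rw [← this] at h
  exact_mod_cast h

theorem loopSet_encard_le {u : α} {N : ℕ} (h : (G.incidenceSet u).encard ≤ N) :
    Finite (G.loopSet u) ∧ Nat.card (G.loopSet u) ≤ N := by
  have hfin : (G.incidenceSet u).Finite := Set.finite_of_encard_le_coe h
  have hsub : G.loopSet u ⊆ G.incidenceSet u := fun e he => ⟨u, he⟩
  refine ⟨hfin.subset hsub, (Set.ncard_le_ncard hsub hfin).trans ?_⟩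
  rw [← hfin.cast_ncard_eq] at h
  exact_mod_cast h

/-- The two ways of listing the non-loop directed edges: by initial and by terminal vertex. -/
def spokeSwap (G : Graph α β) : (Σ u : V(G), G.Spoke u) ≃ (Σ u : V(G), G.Spoke u) where
  toFun x := ⟨x.2.1.2, ⟨(x.2.1.1, x.1), x.2.2.1.symm, x.2.2.2.symm⟩⟩
  invFun x := ⟨x.2.1.2, ⟨(x.2.1.1, x.1), x.2.2.1.symm, x.2.2.2.symm⟩⟩
  left_inv _ := rfl
  right_inv _ := rfl

theorem summable_spoke_fst {N : ℕ} (hN : ∀ u ∈ V(G), (G.incidenceSet u).encard ≤ N)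
    {g : V(G) → ℝ} (hg : ∀ u, 0 ≤ g u) (hs : Summable g) :
    Summable (fun x : Σ u : V(G), G.Spoke u => g x.1) ∧
      ∑' x : (Σ u : V(G), G.Spoke u), g x.1 ≤ N * ∑' u, g u := by
  have hfin : ∀ u : V(G), Finite (G.Spoke u) := fun u => (Spoke.encard_le (hN u u.2)).1
  have hval : ∀ u : V(G), ∑' _ : G.Spoke u, g u = Nat.card (G.Spoke u) * g u := by
    intro u
    rw [tsum_const, nsmul_eq_mul]
  have hle : ∀ u : V(G), ∑' _ : G.Spoke u, g u ≤ N * g u := by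
    intro u
    rw [hval]
    exact mul_le_mul_of_nonneg_right (by exact_mod_cast (Spoke.encard_le (hN u u.2)).2) (hg u)
  have hs1 : Summable fun u : V(G) => ∑' _ : G.Spoke u, g u :=
    Summable.of_nonneg_of_le (fun u => tsum_nonneg fun _ => hg u) hle (hs.mul_left _)
  have hs2 : Summable (fun x : Σ u : V(G), G.Spoke u => g x.1) := by
    rw [summable_sigma_of_nonneg (fun x => hg x.1)]
    exact ⟨fun u => Summable.of_finite, hs1⟩
  refine ⟨hs2, ?_⟩
  rw [hs2.tsum_sigma' (fun u => Summable.of_finite), ← tsum_mul_left]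
  exact hs1.tsum_le_tsum hle (hs.mul_left _)

theorem summable_spoke_snd {N : ℕ} (hN : ∀ u ∈ V(G), (G.incidenceSet u).encard ≤ N)
    {g : V(G) → ℝ} (hg : ∀ u, 0 ≤ g u) (hs : Summable g) :
    Summable (fun x : Σ u : V(G), G.Spoke u => g x.2.1.2) ∧
      ∑' x : (Σ u : V(G), G.Spoke u), g x.2.1.2 ≤ N * ∑' u, g u := by
  obtain ⟨h1, h2⟩ := summable_spoke_fst hN hg hs
  exact ⟨(spokeSwap G).summable_iff.2 h1,
    ((spokeSwap G).tsum_eq (fun x : Σ u : V(G), G.Spoke u => g x.1)).le.trans h2⟩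

theorem summable_sq (f : lp (fun _ : V(G) => ℂ) 2) : Summable fun u => ‖f u‖ ^ 2 := by
  have := (lp.memℓp f).summable (by norm_num)
  simpa using this

theorem norm_sq_eq (f : lp (fun _ : V(G) => ℂ) 2) : ‖f‖ ^ 2 = ∑' u, ‖f u‖ ^ 2 := by
  have := lp.norm_rpow_eq_tsum (p := 2) (by norm_num) f
  simpa using this

theorem jacobiFun_bound (h : G.IsBoundedJacobi a b) :
    ∃ K : ℝ, 0 ≤ K ∧ ∀ f : lp (fun _ : V(G) => ℂ) 2,
      (Summable fun u => ‖G.jacobiFun a b f u‖ ^ 2) ∧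
        ∑' u, ‖G.jacobiFun a b f u‖ ^ 2 ≤ K * ‖f‖ ^ 2 := by
  obtain ⟨N, hN⟩ := h.incidence
  obtain ⟨C, hC⟩ := h.edge
  obtain ⟨B, hB⟩ := h.vertex
  set D : ℝ := |B| + 2 * (N * |C|) with hD
  have hD0 : 0 ≤ D := by positivity
  refine ⟨2 * D ^ 2 + 2 * (|C| ^ 2 * N) * N, by positivity, fun f => ?_⟩
  have hfin : ∀ u : V(G), Finite (G.Spoke u) := fun u => (Spoke.encard_le (hN u u.2)).1
  have hC' : ∀ e ∈ E(G), |a e| ≤ |C| := fun e he => (hC e he).trans (le_abs_self C)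
  have hpt : ∀ u : V(G), ‖G.jacobiFun a b f u‖ ^ 2 ≤
      2 * D ^ 2 * ‖f u‖ ^ 2 + 2 * (|C| ^ 2 * N) * ∑' p : G.Spoke u, ‖f p.1.2‖ ^ 2 := by
    intro u
    have := Fintype.ofFinite (G.Spoke u)
    have hl := loopSet_encard_le (hN u u.2)
    have := hl.1
    have := Fintype.ofFinite (G.loopSet (u : α))
    have e1 : ‖(b u : ℂ) * f u‖ ≤ |B| * ‖f u‖ := by
      rw [norm_mul, Complex.norm_real, Real.norm_eq_abs]
      exact mul_le_mul_of_nonneg_right ((hB u u.2).trans (le_abs_self B)) (norm_nonneg _)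
    have e2 : ‖2 * ∑ᶠ l : G.loopSet (u : α), (a l : ℂ) * f u‖ ≤ 2 * (N * |C|) * ‖f u‖ := by
      rw [finsum_eq_sum_of_fintype, norm_mul, mul_assoc]
      have : ‖(2 : ℂ)‖ = 2 := by norm_num
      rw [this]
      refine mul_le_mul_of_nonneg_left ?_ (by norm_num)
      refine (norm_sum_le _ _).trans ?_
      have : ∀ l ∈ (Finset.univ : Finset (G.loopSet (u : α))),
          ‖(a l : ℂ) * f u‖ ≤ |C| * ‖f u‖ := by
        intro l _
        rw [norm_mul, Complex.norm_real, Real.norm_eq_abs]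
        exact mul_le_mul_of_nonneg_right (hC' _ (IsLink.edge_mem l.2)) (norm_nonneg _)
      refine (Finset.sum_le_sum this).trans ?_
      rw [Finset.sum_const, nsmul_eq_mul, mul_assoc]
      refine mul_le_mul_of_nonneg_right ?_ (by positivity)
      rw [Finset.card_univ, ← Nat.card_eq_fintype_card]
      exact_mod_cast hl.2
    have e3 : ‖∑ᶠ p : G.Spoke u, (a p.1.1 : ℂ) * f p.1.2‖ ≤ |C| * ∑ p : G.Spoke u, ‖f p.1.2‖ := by
      rw [finsum_eq_sum_of_fintype, Finset.mul_sum]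
      refine (norm_sum_le _ _).trans (Finset.sum_le_sum fun p _ => ?_)
      rw [norm_mul, Complex.norm_real, Real.norm_eq_abs]
      exact mul_le_mul_of_nonneg_right (hC' _ (IsLink.edge_mem p.2.1)) (norm_nonneg _)
    have e4 : (∑ p : G.Spoke u, ‖f p.1.2‖) ^ 2 ≤ N * ∑ p : G.Spoke u, ‖f p.1.2‖ ^ 2 := by
      refine (sq_sum_le_card_mul_sum_sq (s := Finset.univ)).trans ?_
      refine mul_le_mul_of_nonneg_right ?_ (by positivity)
      rw [Finset.card_univ, ← Nat.card_eq_fintype_card]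
      exact_mod_cast (Spoke.encard_le (hN u u.2)).2
    rw [tsum_fintype]
    have e5 : ‖G.jacobiFun a b f u‖ ≤ D * ‖f u‖ + |C| * ∑ p : G.Spoke u, ‖f p.1.2‖ := by
      unfold jacobiFun
      refine (norm_add₃_le).trans ?_
      rw [hD, add_mul]
      linarith
    have e6 : 0 ≤ |C| ^ 2 := by positivity
    calc ‖G.jacobiFun a b f u‖ ^ 2
        ≤ (D * ‖f u‖ + |C| * ∑ p : G.Spoke u, ‖f p.1.2‖) ^ 2 := by gcongr
      _ ≤ 2 * D ^ 2 * ‖f u‖ ^ 2 + 2 * (|C| ^ 2 * (∑ p : G.Spoke u, ‖f p.1.2‖) ^ 2) := by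
          nlinarith [sq_nonneg (D * ‖f u‖ - |C| * ∑ p : G.Spoke u, ‖f p.1.2‖)]
      _ ≤ 2 * D ^ 2 * ‖f u‖ ^ 2 + 2 * (|C| ^ 2 * (N * ∑ p : G.Spoke u, ‖f p.1.2‖ ^ 2)) := by
          gcongr
      _ = _ := by ring
  have hs := summable_sq f
  obtain ⟨s1, s2⟩ := summable_spoke_snd hN (fun u => sq_nonneg ‖f u‖) hs
  have s3 := s1.sigma
  have s4 : Summable fun u : V(G) =>
      2 * D ^ 2 * ‖f u‖ ^ 2 + 2 * (|C| ^ 2 * N) * ∑' p : G.Spoke u, ‖f p.1.2‖ ^ 2 :=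
    (hs.mul_left _).add (s3.mul_left _)
  have s5 := Summable.of_nonneg_of_le (fun u => sq_nonneg _) hpt s4
  refine ⟨s5, (s5.tsum_le_tsum hpt s4).trans ?_⟩
  rw [(hs.mul_left _).tsum_add (s3.mul_left _), tsum_mul_left, tsum_mul_left, norm_sq_eq,
    add_mul, ← s1.tsum_sigma' (fun u => Summable.of_finite), mul_assoc (2 * (|C| ^ 2 * N)) (N : ℝ)]
  gcongr

theorem jacobiFun_memℓp (h : G.IsBoundedJacobi a b) (f : lp (fun _ : V(G) => ℂ) 2) :
    Memℓp (G.jacobiFun a b f) 2 := by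
  obtain ⟨K, -, hK⟩ := jacobiFun_bound h
  refine memℓp_gen ?_
  simpa using (hK f).1

theorem jacobiFun_add (h : G.IsBoundedJacobi a b) (f g : V(G) → ℂ) (u : V(G)) :
    G.jacobiFun a b (f + g) u = G.jacobiFun a b f u + G.jacobiFun a b g u := by
  obtain ⟨N, hN⟩ := h.incidence
  have := (Spoke.encard_le (hN u u.2)).1
  have := (loopSet_encard_le (hN u u.2)).1
  have := Fintype.ofFinite (G.Spoke u)
  have := Fintype.ofFinite (G.loopSet (u : α))
  simp only [jacobiFun, finsum_eq_sum_of_fintype, Pi.add_apply, mul_add, Finset.sum_add_distrib]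
  ring

theorem jacobiFun_smul (h : G.IsBoundedJacobi a b) (c : ℂ) (f : V(G) → ℂ) (u : V(G)) :
    G.jacobiFun a b (c • f) u = c * G.jacobiFun a b f u := by
  obtain ⟨N, hN⟩ := h.incidence
  have := (Spoke.encard_le (hN u u.2)).1
  have := (loopSet_encard_le (hN u u.2)).1
  have := Fintype.ofFinite (G.Spoke u)
  have := Fintype.ofFinite (G.loopSet (u : α))
  simp only [jacobiFun, finsum_eq_sum_of_fintype, Pi.smul_apply, smul_eq_mul, mul_add,
    Finset.mul_sum, mul_left_comm _ c]

/-- The Jacobi matrix as a bounded operator on `ℓ²(V(G))`. -/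
noncomputable def jacobiOperator (h : G.IsBoundedJacobi a b) :
    lp (fun _ : V(G) => ℂ) 2 →L[ℂ] lp (fun _ : V(G) => ℂ) 2 :=
  LinearMap.mkContinuousOfExistsBound
    { toFun := fun f => ⟨G.jacobiFun a b f, jacobiFun_memℓp h f⟩
      map_add' := fun f g => by
        ext u
        exact jacobiFun_add h f g u
      map_smul' := fun c f => by
        ext u
        exact jacobiFun_smul h c f u }
    (by
      obtain ⟨K, hK0, hK⟩ := jacobiFun_bound h
      refine ⟨√K, fun f => ?_⟩
      refine le_of_sq_le_sq ?_ (by positivity)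
      rw [mul_pow, Real.sq_sqrt hK0, norm_sq_eq]
      exact (hK f).2)

theorem jacobiOperator_apply (h : G.IsBoundedJacobi a b) (f : lp (fun _ : V(G) => ℂ) 2)
    (u : V(G)) : jacobiOperator h f u = G.jacobiFun a b f u := rfl

theorem jacobiOperator_isSelfAdjoint (h : G.IsBoundedJacobi a b) :
    IsSelfAdjoint (jacobiOperator h) := by
  rw [ContinuousLinearMap.isSelfAdjoint_iff_isSymmetric]
  intro f g
  obtain ⟨N, hN⟩ := h.incidence
  obtain ⟨C, hC⟩ := h.edge
  have hfin : ∀ u : V(G), Finite (G.Spoke u) := fun u => (Spoke.encard_le (hN u u.2)).1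
  have hfin' : ∀ u : V(G), Finite (G.loopSet (u : α)) :=
    fun u => (loopSet_encard_le (hN u u.2)).1
  let d : V(G) → ℂ := fun u => (b u : ℂ) + 2 * ∑ᶠ l : G.loopSet (u : α), (a l : ℂ)
  let F : (Σ u : V(G), G.Spoke u) → ℂ := fun x => (a x.2.1.1 : ℂ) * inner ℂ (f x.2.1.2) (g x.1)
  have hJ : ∀ (k : lp (fun _ : V(G) => ℂ) 2) (u : V(G)), jacobiOperator h k u =
      d u * k u + ∑' p : G.Spoke u, (a p.1.1 : ℂ) * k p.1.2 := by
    intro k u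
    have := Fintype.ofFinite (G.Spoke u)
    have := Fintype.ofFinite (G.loopSet (u : α))
    rw [jacobiOperator_apply]
    simp only [jacobiFun, d, finsum_eq_sum_of_fintype, tsum_fintype, ← Finset.sum_mul]
    ring
  have hd : ∀ u, (starRingEnd ℂ) (d u) = d u := by
    intro u
    have := Fintype.ofFinite (G.loopSet (u : α))
    have h2 : (starRingEnd ℂ) 2 = 2 := map_ofNat _ 2
    simp [d, finsum_eq_sum_of_fintype, h2]
  have hL : ∀ u, inner ℂ (jacobiOperator h f u) (g u) =
      d u * inner ℂ (f u) (g u) + ∑' p : G.Spoke u, F ⟨u, p⟩ := by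
    intro u
    have := Fintype.ofFinite (G.Spoke u)
    rw [hJ, tsum_fintype, tsum_fintype, inner_add_left, sum_inner]
    congr 1
    · simp [hd]; ring
    · refine Finset.sum_congr rfl fun p _ => ?_
      simp [F]; ring
  have hR : ∀ u, inner ℂ (f u) (jacobiOperator h g u) =
      d u * inner ℂ (f u) (g u) + ∑' p : G.Spoke u, F (spokeSwap G ⟨u, p⟩) := by
    intro u
    have := Fintype.ofFinite (G.Spoke u)
    rw [hJ, tsum_fintype, tsum_fintype, inner_add_right, inner_sum]
    congr 1
    · simp; ring
    · refine Finset.sum_congr rfl fun p _ => ?_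
      simp [F, spokeSwap]; ring
  have hF : Summable F := by
    have h1 := (summable_spoke_snd hN (fun u => sq_nonneg ‖f u‖) (summable_sq f)).1
    have h2 := (summable_spoke_fst hN (fun u => sq_nonneg ‖g u‖) (summable_sq g)).1
    refine Summable.of_norm_bounded ((h1.add h2).mul_left |C|) fun x => ?_
    have h3 : ‖F x‖ ≤ |C| * (‖f x.2.1.2‖ * ‖g x.1‖) := by
      simp only [F, norm_mul, Complex.norm_real, Real.norm_eq_abs]
      exact mul_le_mul ((hC _ (IsLink.edge_mem x.2.2.1)).trans (le_abs_self C))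
        (norm_inner_le_norm _ _) (norm_nonneg _) (abs_nonneg _)
    refine h3.trans (mul_le_mul_of_nonneg_left ?_ (abs_nonneg _))
    nlinarith [sq_nonneg (‖f x.2.1.2‖ - ‖g x.1‖), sq_nonneg ‖f x.2.1.2‖, sq_nonneg ‖g x.1‖]
  have hF' : Summable fun x => F (spokeSwap G x) := (spokeSwap G).summable_iff.2 hF
  have hS := hF.sigma
  have hS' := hF'.sigma
  have hP : Summable fun u => d u * inner ℂ (f u) (g u) := by
    have := (lp.summable_inner (𝕜 := ℂ) (jacobiOperator h f) g).sub hS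
    refine this.congr fun u => ?_
    rw [hL]; ring
  change inner ℂ (jacobiOperator h f) g = inner ℂ f (jacobiOperator h g)
  rw [lp.inner_eq_tsum, lp.inner_eq_tsum, tsum_congr hL, tsum_congr hR, hP.tsum_add hS,
    hP.tsum_add hS', ← hF.tsum_sigma, ← hF'.tsum_sigma, (spokeSwap G).tsum_eq F]

end Bounded

/-! ### The universal cover -/

/-- Directed edges. A non-loop edge with ends `x, y` gives the two directed edges `(x, y)` and
`(y, x)` (with flag `false`); a loop (a whole-loop) at `x` gives two directed edges `(x, x)`,
told apart by the flag. -/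
@[ext]
structure Dart (G : Graph α β) where
  edge : β
  src : α
  tgt : α
  flag : Bool
  isLink : G.IsLink edge src tgt
  src_eq_of_flag : flag = true → src = tgt

open Classical in
/-- Reversal of directed edges; it exchanges the two directed edges of every edge or loop. -/
noncomputable def Dart.rev {G : Graph α β} (d : G.Dart) : G.Dart where
  edge := d.edge
  src := d.tgt
  tgt := d.src
  flag := if d.src = d.tgt then !d.flag else false
  isLink := d.isLink.symm
  src_eq_of_flag h := by
    by_contra hne
    rw [if_neg (fun h' => hne h'.symm)] at h
    cases h

theorem Dart.rev_rev {G : Graph α β} (d : G.Dart) : d.rev.rev = d := by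
  have := d.src_eq_of_flag
  ext
  · rfl
  · rfl
  · rfl
  · by_cases h : d.src = d.tgt
    · simp [rev, h]
    · have hf : d.flag = false := by
        cases hd : d.flag
        · rfl
        · exact absurd (this hd) h
      have h' : ¬ d.tgt = d.src := fun h' => h h'.symm
      simp [rev, h', hf]

theorem Dart.rev_ne {G : Graph α β} (d : G.Dart) : d.rev ≠ d := by
  intro h
  have h1 : d.src = d.tgt := congrArg Dart.tgt h
  have h2 := congrArg Dart.flag h
  simp [rev, h1] at h2

theorem Dart.finite {G : Graph α β} (hE : E(G).Finite) (hV : V(G).Finite) : Finite G.Dart := by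
  have := hE.to_subtype
  have := hV.to_subtype
  let φ : G.Dart → E(G) × V(G) × V(G) × Bool := fun d =>
    (⟨d.edge, d.isLink.edge_mem⟩, ⟨d.src, d.isLink.left_mem⟩, ⟨d.tgt, d.isLink.right_mem⟩, d.flag)
  refine Finite.of_injective φ fun d d' h => ?_
  simp only [φ, Prod.mk.injEq, Subtype.mk.injEq] at h
  exact Dart.ext h.1 h.2.1 h.2.2.1 h.2.2.2

/-- The end of a walk from `v₀`. A walk is the list of its directed edges, the last one first, so
that appending the directed edge `d` to `p` gives `d :: p`. -/
def walkEnd {G : Graph α β} (v₀ : α) : List G.Dart → α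
  | [] => v₀
  | d :: _ => d.tgt

/-- Non-backtracking walks from `v₀`: each directed edge starts where the walk before it ends, and
is not the reversal of the directed edge just before it. -/
def IsNonbacktracking {G : Graph α β} (v₀ : α) : List G.Dart → Prop
  | [] => True
  | d :: p => IsNonbacktracking v₀ p ∧ d.src = walkEnd v₀ p ∧ ∀ e ∈ p.head?, d ≠ e.rev

/-- The universal cover of `G` rooted at `v₀`. Its vertices are the non-backtracking walks from
`v₀`. For every such walk of the form `d :: p` there is one edge (labelled by `d :: p`), which
joins `p` to `d :: p`. -/
def universalCover (G : Graph α β) (v₀ : α) : Graph (List G.Dart) (List G.Dart) where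
  vertexSet := {p | IsNonbacktracking v₀ p}
  edgeSet := {q | IsNonbacktracking v₀ q ∧ q ≠ []}
  IsLink q x y := IsNonbacktracking v₀ q ∧ q ≠ [] ∧ (x = q.tail ∧ y = q ∨ x = q ∧ y = q.tail)
  isLink_symm := by
    intro e _
    exact ⟨fun x y h => ⟨h.1, h.2.1, h.2.2.symm.imp And.symm And.symm⟩⟩
  eq_or_eq_of_isLink_of_isLink := by
    rintro e x y v w ⟨-, -, h⟩ ⟨-, -, h'⟩
    rcases h with ⟨rfl, rfl⟩ | ⟨rfl, rfl⟩ <;> rcases h' with ⟨rfl, rfl⟩ | ⟨rfl, rfl⟩ <;> simp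
  edge_mem_iff_exists_isLink := by
    intro q
    constructor
    · rintro ⟨h1, h2⟩
      exact ⟨q.tail, q, h1, h2, Or.inl ⟨rfl, rfl⟩⟩
    · rintro ⟨x, y, h1, h2, -⟩
      exact ⟨h1, h2⟩
  left_mem_of_isLink := by
    rintro q x y ⟨h1, h2, ⟨rfl, -⟩ | ⟨rfl, -⟩⟩
    · cases q with
      | nil => exact absurd rfl h2
      | cons d p => exact h1.1
    · exact h1

/-- The pullback of edge coefficients to the universal cover: the edge joining `p` to `d :: p` lies
over the edge of `d`. -/
def liftEdge {G : Graph α β} (a : β → ℝ) : List G.Dart → ℝ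
  | [] => 0
  | d :: _ => a d.edge

/-- The pullback of vertex coefficients to the universal cover along the covering map `walkEnd`. -/
def liftVertex {G : Graph α β} (v₀ : α) (b : α → ℝ) (p : List G.Dart) : ℝ :=
  b (walkEnd v₀ p)

theorem universalCover_isBoundedJacobi {G : Graph α β} (hV : V(G).Finite) (hE : E(G).Finite)
    (a : β → ℝ) (b : α → ℝ) (v₀ : α) :
    (G.universalCover v₀).IsBoundedJacobi (liftEdge a) (liftVertex v₀ b) := by
  have hD : Finite G.Dart := Dart.finite hE hV
  refine ⟨⟨Nat.card (Option G.Dart), fun p _ => ?_⟩, ?_, ?_⟩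
  · have hsub : (G.universalCover v₀).incidenceSet p ⊆
        Set.range (fun o : Option G.Dart => o.elim p (fun d => d :: p)) := by
      rintro q ⟨y, -, h2, ⟨rfl, -⟩ | ⟨rfl, -⟩⟩
      · cases q with
        | nil => exact absurd rfl h2
        | cons d p => exact ⟨some d, rfl⟩
      · exact ⟨none, rfl⟩
    refine (Set.encard_le_encard hsub).trans ?_
    rw [← Set.image_univ]
    refine (Set.encard_image_le _ _).trans ?_
    rw [Set.encard_univ, ENat.card_eq_coe_natCard]
  · obtain ⟨C, hC⟩ := (Set.finite_range fun d : G.Dart => |a d.edge|).bddAbove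
    refine ⟨C, fun q hq => ?_⟩
    cases q with
    | nil => exact absurd rfl hq.2
    | cons d p => exact hC ⟨d, rfl⟩
  · obtain ⟨C, hC⟩ := (Set.finite_range fun d : G.Dart => |b d.tgt|).bddAbove
    refine ⟨max C |b v₀|, fun p _ => ?_⟩
    cases p with
    | nil => exact le_max_right _ _
    | cons d p => exact (hC ⟨d, rfl⟩).trans (le_max_left _ _)

/-- The pullback to the universal cover of the Jacobi matrix with coefficients `a`, `b` on a finite
graph. -/
noncomputable def coverOperator (G : Graph α β) (hV : V(G).Finite) (hE : E(G).Finite)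
    (a : β → ℝ) (b : α → ℝ) (v₀ : α) :
    lp (fun _ : V(G.universalCover v₀) => ℂ) 2 →L[ℂ] lp (fun _ : V(G.universalCover v₀) => ℂ) 2 :=
  jacobiOperator (universalCover_isBoundedJacobi hV hE a b v₀)

theorem coverOperator_isSelfAdjoint (G : Graph α β) (hV : V(G).Finite) (hE : E(G).Finite)
    (a : β → ℝ) (b : α → ℝ) (v₀ : α) : IsSelfAdjoint (G.coverOperator hV hE a b v₀) :=
  jacobiOperator_isSelfAdjoint _

end Graph

/-! ### Spectral measures and Cauchy transforms -/

section Spectral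

variable {H : Type*} [NormedAddCommGroup H] [InnerProductSpace ℂ H] [CompleteSpace H]

open CompactlySupported in
/-- The positive functional `f ↦ ⟨ψ, f(A) ψ⟩` on continuous functions on the spectrum of a
self-adjoint operator `A`, by the continuous functional calculus. -/
noncomputable def spectralFunctional (A : H →L[ℂ] H) (hA : IsSelfAdjoint A) (ψ : H) :
    C_c(spectrum ℝ A, ℝ) →ₚ[ℝ] ℝ :=
  PositiveLinearMap.mk₀
    { toFun := fun f => (inner ℂ ψ (cfcHom hA f.toContinuousMap ψ)).re
      map_add' := fun f g => by
        have h : (f + g).toContinuousMap = f.toContinuousMap + g.toContinuousMap := rfl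
        simp only [h, map_add, add_apply, inner_add_right, Complex.add_re]
      map_smul' := fun c f => by
        have h : (c • f).toContinuousMap = c • f.toContinuousMap := rfl
        simp only [h, map_smul, smul_apply, RingHom.id_apply, smul_eq_mul]
        rw [← Complex.coe_smul, inner_smul_right, Complex.re_ofReal_mul] }
    (fun f hf => by
      have h : 0 ≤ cfcHom hA f.toContinuousMap := (cfcHom_nonneg_iff hA).2 fun x => hf x
      have h' := (ContinuousLinearMap.nonneg_iff_isPositive _).1 h
      exact (Complex.le_def.1 (h'.inner_nonneg_right ψ)).1)

/-- The spectral measure of a self-adjoint operator `A` at the vector `ψ`: the measure `μ` on the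
real line, carried by the spectrum of `A`, with `∫ f dμ = ⟨ψ, f(A) ψ⟩`. -/
noncomputable def spectralMeasure (A : H →L[ℂ] H) (hA : IsSelfAdjoint A) (ψ : H) :
    MeasureTheory.Measure ℝ :=
  (RealRMK.rieszMeasure (spectralFunctional A hA ψ)).map Subtype.val

end Spectral

/-- The Cauchy transform of a measure on the real line. -/
noncomputable def cauchyTransform (μ : MeasureTheory.Measure ℝ) (z : ℂ) : ℂ :=
  ∫ t : ℝ, 1 / (z - (t : ℂ)) ∂μ

namespace Graph

variable {α β : Type*}

open Classical in
/-- The Cauchy transform `w` of the spectral measure of the pulled-back Jacobi matrix with respect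
to the vertex `p` of the universal cover, that is, at the vector `δ_p`. -/
noncomputable def coverCauchy (G : Graph α β) (hV : V(G).Finite) (hE : E(G).Finite)
    (a : β → ℝ) (b : α → ℝ) (v₀ : α) (p : V(G.universalCover v₀)) (z : ℂ) : ℂ :=
  cauchyTransform
    (spectralMeasure (G.coverOperator hV hE a b v₀) (G.coverOperator_isSelfAdjoint hV hE a b v₀)
      (lp.single 2 p 1)) z

/-- The system of equations, one for each vertex `u`, for numbers `w_u` at the point `z`;
`Complex.sqrt` is the principal branch. -/
def AomotoSystem (G : Graph α β) (a : β → ℝ) (b : α → ℝ) (z : ℂ) (w : V(G) → ℂ) : Prop :=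
  ∀ u : V(G), w u = 1 / (2 * (z - (b u : ℂ))) *
    (2 - (G.degree u : ℂ)
      + (∑ᶠ p : G.Spoke u, Complex.sqrt (1 + 4 * (a p.1.1 : ℂ) ^ 2 * w u * w p.1.2))
      + ∑ᶠ l : G.loopSet u, 2 * Complex.sqrt (1 + 4 * (a l : ℂ) ^ 2 * w u ^ 2))

end Graph

/-! The equations are the diagonal equation of the resolvent on the tree, with off-diagonal entries
eliminated by a quadratic identity. Write R = (z - A)⁻¹, let p and q be adjacent in the cover with
edge coefficient a, and put g = (R δ_p)(q), P = (R δ_p)(p), Q = (R δ_q)(q). The Cauchy transforms at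
p and q are P and Q (`exists_resolvent`). Deck transformations commute with A, so P depends only on
the end of the walk p (`green_comp_deck`).

Removing the edge disconnects the tree. Truncating R δ_p to the side of p gives g = a(PQ - g²)
(`green_edge`), that is, 1 + 4a²PQ = (1 + 2ag)². As soon as Re(ag) > -1/2, the principal root is 1 +
2ag. Substituting in (z - b)P = 1 + ∑ ag (`green_vertex`), where the sum runs over the directed
edges from the end of p, gives the equation at that vertex (`aomoto_equation_of_green`).

Only the branch remains. Near infinity R is small, hence so is ag (`neg_half_lt_green_edge_re`). At
real points off the convex hull of the spectrum the form of R has constant sign, so Cauchy–Schwarz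
and the quadratic identity give Re(ag) ≥ 0 (`green_edge_re_nonneg`). -/

namespace Graph

/-! ### Reduced walks under concatenation with cancellation. -/

section Walks

variable {α β : Type*} {G : Graph α β}

open Classical in
/-- Append a directed edge to a walk, cancelling it against the last directed edge if that one is
its reversal. -/
noncomputable def walkStep (p : List G.Dart) (d : G.Dart) : List G.Dart :=
  if p.head? = some d.rev then p.tail else d :: p

/-- Append a walk `q` to the walk `p`, with cancellation. -/
noncomputable def walkConcat (p q : List G.Dart) : List G.Dart :=
  q.foldr (fun d x => walkStep x d) p

@[simp] theorem Dart.rev_src (d : G.Dart) : d.rev.src = d.tgt := rfl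
@[simp] theorem Dart.rev_tgt (d : G.Dart) : d.rev.tgt = d.src := rfl
@[simp] theorem Dart.rev_edge (d : G.Dart) : d.rev.edge = d.edge := rfl

theorem walkStep_rev_cons (d : G.Dart) (p : List G.Dart) : walkStep (d.rev :: p) d = p := by
  simp [walkStep]

theorem walkStep_cons_rev (d : G.Dart) (p : List G.Dart) : walkStep (d :: p) d.rev = p := by
  simp [walkStep, Dart.rev_rev]

theorem walkStep_of_head_ne {d : G.Dart} {p : List G.Dart} (h : p.head? ≠ some d.rev) :
    walkStep p d = d :: p := if_neg h

/-- The cancelling case is phrased as a decomposition of `p`, so that what is known of `p` passes to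
the shorter walk. -/
theorem walkStep_cases (p : List G.Dart) (d : G.Dart) :
    p = d.rev :: walkStep p d ∨ p.head? ≠ some d.rev ∧ walkStep p d = d :: p := by
  by_cases h : p.head? = some d.rev
  · left
    obtain ⟨p', rfl⟩ := List.head?_eq_some_iff.1 h
    rw [walkStep_rev_cons]
  · exact Or.inr ⟨h, walkStep_of_head_ne h⟩

theorem IsNonbacktracking.head_ne {v : α} {d : G.Dart} {p : List G.Dart}
    (h : IsNonbacktracking v (d :: p)) : p.head? ≠ some d.rev := by
  intro hp
  exact h.2.2 _ hp d.rev_rev.symm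

theorem IsNonbacktracking.walkStep_eq {v : α} {d : G.Dart} {p : List G.Dart}
    (h : IsNonbacktracking v (d :: p)) : walkStep p d = d :: p :=
  walkStep_of_head_ne h.head_ne

theorem IsNonbacktracking.walkStep {v : α} {p : List G.Dart} (hp : IsNonbacktracking v p)
    {d : G.Dart} (hd : d.src = walkEnd v p) : IsNonbacktracking v (walkStep p d) := by
  rcases walkStep_cases p d with h | ⟨h, h'⟩
  · rw [h] at hp
    exact hp.1
  · rw [h']
    refine ⟨hp, hd, fun e he hde => h ?_⟩
    rw [hde, Dart.rev_rev]
    exact he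

theorem IsNonbacktracking.walkEnd_walkStep {v : α} {p : List G.Dart} (hp : IsNonbacktracking v p)
    (d : G.Dart) : walkEnd v (Graph.walkStep p d) = d.tgt := by
  rcases walkStep_cases p d with h | ⟨h, h'⟩
  · rw [h] at hp
    exact hp.2.1.symm
  · rw [h']
    rfl

/-- If the first step cancels, `p` ends with `d.rev`; because `p` is reduced, appending `d.rev`
again does not cancel and restores `p`. -/
theorem IsNonbacktracking.walkStep_walkStep_rev {v : α} {p : List G.Dart}
    (hp : IsNonbacktracking v p) (d : G.Dart) :
    Graph.walkStep (Graph.walkStep p d) d.rev = p := by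
  rcases walkStep_cases p d with h | ⟨-, h⟩
  · nth_rw 2 [h]
    rw [h] at hp
    exact hp.walkStep_eq
  · rw [h, walkStep_cons_rev]

theorem walkStep_injective (p : List G.Dart) : Function.Injective (walkStep p) := by
  intro d e h
  rcases walkStep_cases p d with hd | ⟨-, hd⟩ <;> rcases walkStep_cases p e with he | ⟨-, he⟩
  · have h1 := congrArg Dart.rev (List.cons.inj (hd.symm.trans he)).1
    rwa [Dart.rev_rev, Dart.rev_rev] at h1
  · have h1 := congrArg List.length hd
    rw [h, he] at h1
    simp at h1
    omega
  · have h1 := congrArg List.length he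
    rw [← h, hd] at h1
    simp at h1
    omega
  · rw [hd, he] at h
    exact (List.cons.inj h).1

theorem walkConcat_nonbacktracking {v : α} {p : List G.Dart} (hp : IsNonbacktracking v p) :
    ∀ {q : List G.Dart}, IsNonbacktracking (walkEnd v p) q →
      IsNonbacktracking v (walkConcat p q) ∧
        walkEnd v (walkConcat p q) = walkEnd (walkEnd v p) q
  | [], _ => ⟨hp, rfl⟩
  | d :: q, hq => by
    obtain ⟨h1, h2⟩ := walkConcat_nonbacktracking hp hq.1
    exact ⟨h1.walkStep (hq.2.1.trans h2.symm), h1.walkEnd_walkStep d⟩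

/-- Left concatenation commutes with steps at the end, which makes deck maps preserve adjacency.
When `d` cancels in `q`, it also undoes the last step of the concatenated walk. -/
theorem walkConcat_walkStep {v : α} {p q : List G.Dart} (hp : IsNonbacktracking v p)
    (hq : IsNonbacktracking (walkEnd v p) q) (d : G.Dart) :
    walkConcat p (walkStep q d) = walkStep (walkConcat p q) d := by
  rcases walkStep_cases q d with h | ⟨-, h⟩
  · nth_rw 2 [h]
    rw [h] at hq
    have h1 := (walkConcat_nonbacktracking hp hq.1).1.walkStep_walkStep_rev d.rev
    rw [Dart.rev_rev] at h1
    exact h1.symm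
  · rw [h]
    rfl

theorem walkConcat_nil_left {v : α} :
    ∀ {q : List G.Dart}, IsNonbacktracking v q → walkConcat [] q = q
  | [], _ => rfl
  | d :: q, hq => by
    change walkStep (walkConcat [] q) d = _
    rw [walkConcat_nil_left hq.1, hq.walkStep_eq]

theorem walkConcat_assoc {v : α} {p q : List G.Dart} (hp : IsNonbacktracking v p)
    (hq : IsNonbacktracking (walkEnd v p) q) :
    ∀ {r : List G.Dart}, IsNonbacktracking (walkEnd (walkEnd v p) q) r →
      walkConcat (walkConcat p q) r = walkConcat p (walkConcat q r)
  | [], _ => rfl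
  | d :: r, hr => by
    change walkStep (walkConcat (walkConcat p q) r) d = walkConcat p (walkStep (walkConcat q r) d)
    rw [walkConcat_walkStep hp (walkConcat_nonbacktracking hq hr.1).1,
      walkConcat_assoc hp hq hr.1]

/-- If `r` inverts `p`, then `d.rev` followed by `r` inverts `d :: p`. The inverse yields both left
cancellation and transitivity of closed walks on fibres. -/
theorem IsNonbacktracking.exists_inverse {v : α} :
    ∀ {p : List G.Dart}, IsNonbacktracking v p →
      ∃ r : List G.Dart, IsNonbacktracking (walkEnd v p) r ∧ walkEnd (walkEnd v p) r = v ∧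
        walkConcat r p = []
  | [], _ => ⟨[], trivial, rfl, rfl⟩
  | d :: p, hp => by
    obtain ⟨r, h1, h2, h3⟩ := exists_inverse hp.1
    have hd : IsNonbacktracking d.tgt [d.rev] := ⟨trivial, rfl, by simp⟩
    have he : walkEnd d.tgt [d.rev] = walkEnd v p := hp.2.1
    rw [← he] at h1 h2
    obtain ⟨h4, h5⟩ := walkConcat_nonbacktracking hd h1
    refine ⟨walkConcat [d.rev] r, h4, h5.trans h2, ?_⟩
    change Graph.walkStep (walkConcat (walkConcat [d.rev] r) p) d = []
    rw [walkConcat_assoc hd h1 (by rw [h2]; exact hp.1), h3]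
    exact walkStep_rev_cons d []

theorem walkConcat_left_cancel {v : α} {x p q : List G.Dart} (hx : IsNonbacktracking v x)
    (hp : IsNonbacktracking (walkEnd v x) p) (hq : IsNonbacktracking (walkEnd v x) q)
    (h : walkConcat x p = walkConcat x q) : p = q := by
  obtain ⟨r, h1, h2, h3⟩ := hx.exists_inverse
  have key : ∀ {s : List G.Dart}, IsNonbacktracking (walkEnd v x) s →
      walkConcat r (walkConcat x s) = s := by
    intro s hs
    rw [← walkConcat_assoc h1 (by rw [h2]; exact hx) (by rw [h2]; exact hs), h3,
      walkConcat_nil_left hs]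
  rw [← key hp, h, key hq]

/-- Two walks with the same end differ by left concatenation with a closed walk. -/
theorem exists_walkConcat_eq {v : α} {p q : List G.Dart} (hp : IsNonbacktracking v p)
    (hq : IsNonbacktracking v q) (h : walkEnd v p = walkEnd v q) :
    ∃ x : List G.Dart, IsNonbacktracking v x ∧ walkEnd v x = v ∧ walkConcat x p = q := by
  obtain ⟨r, h1, h2, h3⟩ := hp.exists_inverse
  rw [h] at h1 h2
  obtain ⟨h4, h5⟩ := walkConcat_nonbacktracking hq h1
  refine ⟨walkConcat q r, h4, h5.trans h2, ?_⟩
  rw [walkConcat_assoc hq h1 (by rw [h2]; exact hp), h3]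
  rfl

end Walks

/-! ### Neighbours, deck transformations and cuts in the universal cover. -/

section Cover

variable {α β : Type*} {G : Graph α β} {v₀ : α}

/-- The directed edges that start at `u`. -/
abbrev DartFrom (G : Graph α β) (u : α) : Type _ := {d : G.Dart // d.src = u}

/-- The neighbour of a vertex of the universal cover along a directed edge. -/
noncomputable def coverStep (p : V(G.universalCover v₀))
    (d : G.DartFrom (walkEnd v₀ (p : List G.Dart))) : V(G.universalCover v₀) :=
  ⟨walkStep p.1 d.1, IsNonbacktracking.walkStep p.2 d.2⟩

theorem walkEnd_coverStep (p : V(G.universalCover v₀))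
    (d : G.DartFrom (walkEnd v₀ (p : List G.Dart))) :
    walkEnd v₀ (coverStep p d : List G.Dart) = d.1.tgt :=
  IsNonbacktracking.walkEnd_walkStep p.2 d.1

theorem coverStep_injective (p : V(G.universalCover v₀)) : Function.Injective (coverStep p) :=
  fun _ _ h => Subtype.ext (walkStep_injective p.1 (congrArg Subtype.val h))

/-- The ends of an edge are walks whose lengths differ by one. -/
theorem universalCover_not_isLink_self (q p : List G.Dart) :
    ¬ (G.universalCover v₀).IsLink q p p := by
  rintro ⟨-, h, ⟨h1, h2⟩ | ⟨h1, h2⟩⟩ <;>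
  · have h3 : q = q.tail := by first | exact h2.symm.trans h1 | exact h1.symm.trans h2
    have h4 := congrArg List.length h3
    have h5 := List.length_pos_of_ne_nil h
    simp at h4
    omega

open Classical in
/-- The edge of the universal cover between `p` and its neighbour along `d`. -/
noncomputable def stepEdge (p : List G.Dart) (d : G.Dart) : List G.Dart :=
  if p.head? = some d.rev then p else d :: p

theorem universalCover_isLink_stepEdge (p : V(G.universalCover v₀))
    (d : G.DartFrom (walkEnd v₀ (p : List G.Dart))) :
    (G.universalCover v₀).IsLink (stepEdge p.1 d.1) p.1 (coverStep p d).1 := by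
  have hp := p.2
  have hs := (coverStep p d).2
  change IsNonbacktracking v₀ (walkStep p.1 d.1) at hs
  change (G.universalCover v₀).IsLink (stepEdge p.1 d.1) p.1 (walkStep p.1 d.1)
  by_cases h : p.1.head? = some d.1.rev
  · have h1 : stepEdge p.1 d.1 = p.1 := if_pos h
    have h2 : walkStep p.1 d.1 = p.1.tail := if_pos h
    rw [h1, h2]
    refine ⟨hp, fun h0 => ?_, Or.inr ⟨rfl, rfl⟩⟩
    simp [h0] at h
  · have h1 : stepEdge p.1 d.1 = d.1 :: p.1 := if_neg h
    have h2 : walkStep p.1 d.1 = d.1 :: p.1 := if_neg h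
    rw [h2] at hs
    rw [h1, h2]
    exact ⟨hs, List.cons_ne_nil _ _, Or.inl ⟨rfl, rfl⟩⟩

theorem liftEdge_stepEdge (a : β → ℝ) (p : List G.Dart) (d : G.Dart) :
    liftEdge a (stepEdge p d) = a d.edge := by
  by_cases h : p.head? = some d.rev
  · have h1 : stepEdge p d = p := if_pos h
    rw [h1]
    obtain ⟨p', rfl⟩ := List.head?_eq_some_iff.1 h
    rfl
  · have h1 : stepEdge p d = d :: p := if_neg h
    rw [h1]
    rfl

/-- The edges at a vertex of the universal cover lie over the directed edges from its image. -/
noncomputable def coverSpoke (p : V(G.universalCover v₀))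
    (d : G.DartFrom (walkEnd v₀ (p : List G.Dart))) : (G.universalCover v₀).Spoke p.1 :=
  ⟨(stepEdge p.1 d.1, coverStep p d), universalCover_isLink_stepEdge p d, fun h =>
    universalCover_not_isLink_self (v₀ := v₀) (stepEdge p.1 d.1) p.1
      (by have := universalCover_isLink_stepEdge p d; rwa [h] at this)⟩

/-- An edge at `p` is labelled either by an extension of `p` or by `p` itself; the latter is the
step along the reversal of the last directed edge of `p`. -/
theorem coverSpoke_bijective (p : V(G.universalCover v₀)) :
    Function.Bijective (coverSpoke p) := by
  constructor
  · intro d e h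
    exact coverStep_injective p (congrArg (fun s => s.1.2) h)
  · rintro ⟨⟨q, y, hy⟩, hl, hne⟩
    have hl' := hl
    obtain ⟨h1, h2, ⟨h3, h4⟩ | ⟨h3, h4⟩⟩ := hl
    · obtain ⟨d, p', rfl⟩ := List.exists_cons_of_ne_nil h2
      have h3' : p.1 = p' := h3
      refine ⟨⟨d, by rw [h3']; exact h1.2.1⟩, Spoke.injective_edge p.1 ?_⟩
      change stepEdge p.1 d = d :: p'
      rw [h3']
      exact if_neg h1.head_ne
    · obtain ⟨d, p', rfl⟩ := List.exists_cons_of_ne_nil h2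
      refine ⟨⟨d.rev, by rw [h3]; rfl⟩, Spoke.injective_edge p.1 ?_⟩
      change stepEdge p.1 d.rev = d :: p'
      rw [h3]
      exact if_pos (by simp [Dart.rev_rev])

/-- The cover has no loops. A loop of `G` enters through its two directed edges, which lead to two
different neighbours. -/
theorem jacobiFun_universalCover (a : β → ℝ) (b : α → ℝ) (f : V(G.universalCover v₀) → ℂ)
    (p : V(G.universalCover v₀)) :
    (G.universalCover v₀).jacobiFun (liftEdge a) (liftVertex v₀ b) f p =
      (b (walkEnd v₀ (p : List G.Dart)) : ℂ) * f p +
        ∑ᶠ d : G.DartFrom (walkEnd v₀ (p : List G.Dart)),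
          (a d.1.edge : ℂ) * f (coverStep p d) := by
  have : IsEmpty ((G.universalCover v₀).loopSet (p : List G.Dart)) :=
    ⟨fun l => universalCover_not_isLink_self _ _ l.2⟩
  have h0 : ∑ᶠ l : (G.universalCover v₀).loopSet (p : List G.Dart),
      ((liftEdge a l.1 : ℝ) : ℂ) * f p = 0 :=
    finsum_of_isEmpty _
  rw [jacobiFun, h0, mul_zero, add_zero]
  congr 1
  symm
  refine finsum_eq_of_bijective (coverSpoke p) (coverSpoke_bijective p) fun d => ?_
  change _ = ((liftEdge a (stepEdge p.1 d.1) : ℝ) : ℂ) * _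
  rw [liftEdge_stepEdge]
  rfl

/-- A closed walk acts on the universal cover by concatenation on the left. -/
noncomputable def deckMap {x : List G.Dart} (hx : IsNonbacktracking v₀ x) (hc : walkEnd v₀ x = v₀)
    (p : V(G.universalCover v₀)) : V(G.universalCover v₀) :=
  ⟨walkConcat x p.1, (walkConcat_nonbacktracking hx (by rw [hc]; exact p.2)).1⟩

variable {x : List G.Dart} (hx : IsNonbacktracking v₀ x) (hc : walkEnd v₀ x = v₀)

theorem deckMap_injective : Function.Injective (deckMap hx hc) := fun p q h =>
  Subtype.ext (walkConcat_left_cancel hx (by rw [hc]; exact p.2) (by rw [hc]; exact q.2)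
    (congrArg Subtype.val h))

theorem walkEnd_deckMap (p : V(G.universalCover v₀)) :
    walkEnd v₀ (deckMap hx hc p : List G.Dart) = walkEnd v₀ (p : List G.Dart) := by
  refine (walkConcat_nonbacktracking hx (by rw [hc]; exact p.2)).2.trans ?_
  rw [hc]

/-- A deck map is an automorphism of the weighted tree: it commutes with steps and keeps the end of
the walk, and these determine the coefficients. -/
theorem jacobiFun_comp_deckMap (a : β → ℝ) (b : α → ℝ) (f : V(G.universalCover v₀) → ℂ)
    (p : V(G.universalCover v₀)) :
    (G.universalCover v₀).jacobiFun (liftEdge a) (liftVertex v₀ b) (f ∘ deckMap hx hc) p =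
      (G.universalCover v₀).jacobiFun (liftEdge a) (liftVertex v₀ b) f (deckMap hx hc p) := by
  rw [jacobiFun_universalCover, jacobiFun_universalCover]
  congr 1
  · rw [walkEnd_deckMap, Function.comp_apply]
  refine finsum_eq_of_bijective
    (fun d => ⟨d.1, d.2.trans (walkEnd_deckMap hx hc p).symm⟩) ?_ fun d => ?_
  · exact ⟨fun d e h => Subtype.ext (congrArg (fun s => s.1) h),
      fun d => ⟨⟨d.1, d.2.trans (walkEnd_deckMap hx hc p)⟩, rfl⟩⟩
  · have : deckMap hx hc (coverStep p d) =
        coverStep (deckMap hx hc p) ⟨d.1, d.2.trans (walkEnd_deckMap hx hc p).symm⟩ :=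
      Subtype.ext (walkConcat_walkStep hx (by rw [hc]; exact p.2) d.1)
    simp only [Function.comp_apply, this]

/-- Removing an edge from the universal cover leaves its ends on different sides. -/
theorem exists_cut (p : V(G.universalCover v₀))
    (d : G.DartFrom (walkEnd v₀ (p : List G.Dart))) :
    ∃ S : Set V(G.universalCover v₀), p ∈ S ∧ coverStep p d ∉ S ∧
      ∀ q e, ¬ (q = p ∧ coverStep q e = coverStep p d) →
        ¬ (q = coverStep p d ∧ coverStep q e = p) → (coverStep q e ∈ S ↔ q ∈ S) := by
  -- Lists are written last edge first, so `c <:+ q` says that the walk `q` begins with `c`: `q`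
  -- lies in the subtree beyond `c`. A step changes this only by crossing the edge between `c.tail`
  -- and `c`.
  have key : ∀ (c q : List G.Dart) (e : G.Dart), c ≠ [] →
      ¬ (q = c.tail ∧ walkStep q e = c) → ¬ (q = c ∧ walkStep q e = c.tail) →
      (c <:+ walkStep q e ↔ c <:+ q) := by
    intro c q e hc h1 h2
    rcases walkStep_cases q e with h | ⟨-, h⟩
    · have h3 : c <:+ q ↔ c = q ∨ c <:+ walkStep q e := by
        conv_lhs => rw [h]
        rw [List.suffix_cons_iff, ← h]
      rw [h3]
      refine ⟨Or.inr, fun h4 => h4.resolve_left fun h5 => h2 ⟨h5.symm, ?_⟩⟩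
      rw [h5]
      conv_rhs => rw [h]
      rfl
    · rw [h, List.suffix_cons_iff]
      refine ⟨fun h4 => h4.resolve_left fun h5 => h1 ⟨by rw [h5]; rfl, by rw [h, h5]⟩, Or.inr⟩
  have hstep : (coverStep p d).1 = walkStep p.1 d.1 := rfl
  -- Take `c` to be the longer end of the edge. If the step cancels, this is `p` and `S` is its
  -- subtree; otherwise it is `coverStep p d` and `S` is the complement of its subtree.
  rcases walkStep_cases p.1 d.1 with h | ⟨-, h⟩
  · refine ⟨{q | p.1 <:+ q.1}, List.suffix_refl _, ?_, fun q e h1 h2 => ?_⟩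
    · intro h3
      have h4 := List.IsSuffix.length_le h3
      have h5 := congrArg List.length h
      rw [List.length_cons] at h5
      rw [hstep] at h4
      omega
    · have h6 : p.1.tail = walkStep p.1 d.1 := by
        conv_lhs => rw [h]
        rfl
      refine key p.1 q.1 e.1 (by rw [h]; simp) (fun h3 => h2 ?_) (fun h3 => h1 ?_)
      · exact ⟨Subtype.ext (h3.1.trans h6), Subtype.ext h3.2⟩
      · exact ⟨Subtype.ext h3.1, Subtype.ext (h3.2.trans h6)⟩
  · refine ⟨{q | ¬ (coverStep p d).1 <:+ q.1}, ?_, ?_, fun q e h1 h2 => not_congr ?_⟩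
    · intro h3
      have h4 := List.IsSuffix.length_le h3
      rw [hstep, h, List.length_cons] at h4
      omega
    · simp
    · have h6 : (coverStep p d).1.tail = p.1 := by rw [hstep, h]; rfl
      refine key _ q.1 e.1 (by rw [hstep, h]; simp) (fun h3 => h1 ?_) (fun h3 => h2 ?_)
      · exact ⟨Subtype.ext (h3.1.trans h6), Subtype.ext h3.2⟩
      · exact ⟨Subtype.ext h3.1, Subtype.ext (h3.2.trans h6)⟩

end Cover

/-! ### Sums over directed edges versus sums over edges and loops. -/

section DartSums

variable {α β : Type*} {G : Graph α β}

/-- Directed edges from `u` are the non-loop edges at `u`, and two for each loop at `u`. -/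
def dartOfSpoke (u : V(G)) : G.Spoke (u : α) ⊕ (G.loopSet (u : α)) × Bool → G.DartFrom (u : α)
  | Sum.inl s => ⟨⟨s.1.1, u, s.1.2, false, s.2.1, by simp⟩, rfl⟩
  | Sum.inr l => ⟨⟨l.1, u, u, l.2, l.1.2, fun _ => rfl⟩, rfl⟩

theorem dartOfSpoke_bijective (u : V(G)) : Function.Bijective (dartOfSpoke u) := by
  constructor
  · rintro (s | ⟨l, i⟩) (t | ⟨m, j⟩) h
    · exact congrArg Sum.inl (Spoke.injective_edge _ (congrArg (fun d => d.1.edge) h))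
    · exact absurd (congrArg (fun d => d.1.tgt) h) s.2.2
    · exact absurd (congrArg (fun d => d.1.tgt) h).symm t.2.2
    · have h1 : l = m := Subtype.ext (congrArg (fun d => d.1.edge) h)
      have h2 : i = j := congrArg (fun d => d.1.flag) h
      rw [h1, h2]
  · rintro ⟨⟨e, x, y, i, hl, hi⟩, rfl : x = u⟩
    by_cases hy : y = u
    · subst hy
      exact ⟨Sum.inr (⟨e, hl⟩, i), rfl⟩
    · have : i = false := by
        cases i
        · rfl
        · exact absurd (hi rfl).symm hy
      subst this
      exact ⟨Sum.inl ⟨(e, ⟨y, hl.right_mem⟩), hl, hy⟩, rfl⟩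

theorem finite_loopSet (hE : E(G).Finite) (u : α) : Finite (G.loopSet u) :=
  hE.subset fun _ he => IsLink.edge_mem he

theorem finite_spoke (hE : E(G).Finite) (u : α) : Finite (G.Spoke u) := by
  have := hE.to_subtype
  exact Finite.of_injective (fun s : G.Spoke u => (⟨s.1.1, s.2.1.edge_mem⟩ : E(G)))
    fun s t h => Spoke.injective_edge u (congrArg Subtype.val h)

theorem finsum_dartFrom (hE : E(G).Finite) (u : V(G)) (F : β → V(G) → ℂ) :
    ∑ᶠ d : G.DartFrom (u : α), F d.1.edge ⟨d.1.tgt, d.1.isLink.right_mem⟩ =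
      (∑ᶠ s : G.Spoke (u : α), F s.1.1 s.1.2) + ∑ᶠ l : G.loopSet (u : α), 2 * F l u := by
  have := finite_loopSet hE (u : α)
  have := finite_spoke hE (u : α)
  have := Fintype.ofFinite (G.loopSet (u : α))
  have := Fintype.ofFinite (G.Spoke (u : α))
  rw [← finsum_eq_of_bijective (dartOfSpoke u) (dartOfSpoke_bijective u) (fun _ => rfl),
    finsum_eq_sum_of_fintype, finsum_eq_sum_of_fintype, finsum_eq_sum_of_fintype,
    Fintype.sum_sum_type, Fintype.sum_prod_type]
  congr 1
  refine Finset.sum_congr rfl fun l _ => ?_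
  rw [Fintype.sum_bool, two_mul]
  rfl

/-- The constants 1 in the roots 1 + 2ag, summed over directed edges, thus cancel the degree in the
system. -/
theorem degree_eq_card_dartFrom (hE : E(G).Finite) (u : V(G)) :
    G.degree (u : α) = Nat.card (G.DartFrom (u : α)) := by
  have := finite_loopSet hE (u : α)
  have := finite_spoke hE (u : α)
  rw [← Nat.card_eq_of_bijective _ (dartOfSpoke_bijective u), Nat.card_sum, Nat.card_prod, degree,
    Nat.card_eq_fintype_card (α := Bool), Fintype.card_bool, mul_comm]
  congr 1
  let φ : G.Spoke (u : α) → {e | G.IsNonloopAt e (u : α)} := fun s =>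
    ⟨s.1.1, s.1.2, s.2.2, s.2.1⟩
  refine (Nat.card_eq_of_bijective φ ⟨fun s t h => ?_, ?_⟩).symm
  · exact Spoke.injective_edge _ (congrArg Subtype.val h)
  · rintro ⟨e, y, hy, hl⟩
    exact ⟨⟨(e, ⟨y, hl.right_mem⟩), hl, hy⟩, rfl⟩

end DartSums

end Graph

/-! ### The resolvent and the Cauchy transform of the spectral measure. -/

section Resolvent

variable {H : Type*} [NormedAddCommGroup H] [InnerProductSpace ℂ H] [CompleteSpace H]

open CompactlySupported in
theorem spectralMeasure_integral (A : H →L[ℂ] H) (hA : IsSelfAdjoint A) (ψ : H)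
    (f : C(spectrum ℝ A, ℝ)) :
    ∫ t, f t ∂(RealRMK.rieszMeasure (spectralFunctional A hA ψ)) =
      (inner ℂ ψ (cfcHom hA f ψ)).re :=
  RealRMK.integral_rieszMeasure (spectralFunctional A hA ψ)
    (⟨f, HasCompactSupport.of_compactSpace f⟩ : C_c(spectrum ℝ A, ℝ))

/-- For real `f` the operator f(A) is self-adjoint, so the real part taken in `spectralFunctional`
loses nothing. -/
theorem inner_cfcHom_re (A : H →L[ℂ] H) (hA : IsSelfAdjoint A) (ψ : H) (f : C(spectrum ℝ A, ℝ)) :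
    (((inner ℂ ψ (cfcHom hA f ψ)).re : ℝ) : ℂ) = inner ℂ ψ (cfcHom hA f ψ) := by
  have h : IsSelfAdjoint (cfcHom hA f) := by
    have := map_star (cfcHom hA) f
    rw [star_trivial] at this
    exact this.symm
  exact (ContinuousLinearMap.isSelfAdjoint_iff_isSymmetric.1 h).coe_re_inner_self_apply ψ

theorem cauchyTransform_spectralMeasure_eq_integral (A : H →L[ℂ] H) (hA : IsSelfAdjoint A) (ψ : H)
    (z : ℂ) :
    cauchyTransform (spectralMeasure A hA ψ) z =
      ∫ t : spectrum ℝ A, 1 / (z - ((t : ℝ) : ℂ))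
        ∂(RealRMK.rieszMeasure (spectralFunctional A hA ψ)) :=
  (MeasurableEmbedding.subtype_coe (spectrum.isClosed (𝕜 := ℝ) A).measurableSet).integral_map _

/-- The functional calculus used is real, so 1/(z - t) is split as g₁ + i g₂ and R is g₁(A) + i
g₂(A). The inverse is two-sided because both operators commute with `A`. -/
theorem exists_resolvent (A : H →L[ℂ] H) (hA : IsSelfAdjoint A) (z : ℂ)
    (hz : ∀ t ∈ spectrum ℝ A, z ≠ (t : ℂ)) :
    ∃ R : H →L[ℂ] H, (∀ v, z • R v - A (R v) = v) ∧ (∀ v, R (z • v - A v) = v) ∧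
      ∀ ψ, cauchyTransform (spectralMeasure A hA ψ) z = inner ℂ ψ (R ψ) := by
  have hne : ∀ t : spectrum ℝ A, z - ((t : ℝ) : ℂ) ≠ 0 := fun t => sub_ne_zero.2 (hz t t.2)
  have hcont : Continuous fun t : spectrum ℝ A => 1 / (z - ((t : ℝ) : ℂ)) :=
    continuous_const.div (continuous_const.sub (Complex.continuous_ofReal.comp
      continuous_subtype_val)) hne
  let g₁ : C(spectrum ℝ A, ℝ) := ⟨fun t => (1 / (z - ((t : ℝ) : ℂ))).re,
    Complex.continuous_re.comp hcont⟩
  let g₂ : C(spectrum ℝ A, ℝ) := ⟨fun t => (1 / (z - ((t : ℝ) : ℂ))).im,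
    Complex.continuous_im.comp hcont⟩
  let i : C(spectrum ℝ A, ℝ) := (ContinuousMap.id ℝ).restrict (spectrum ℝ A)
  have hi : cfcHom hA i = A := cfcHom_id hA
  have hmul : ∀ t : spectrum ℝ A, (z - ((t : ℝ) : ℂ)) * ((g₁ t : ℂ) + (g₂ t : ℂ) * Complex.I) = 1 := by
    intro t
    have : (g₁ t : ℂ) + (g₂ t : ℂ) * Complex.I = 1 / (z - ((t : ℝ) : ℂ)) := Complex.re_add_im _
    rw [this, mul_one_div_cancel (hne t)]
  -- `e₁` and `e₂` are the real and imaginary parts of (z - t)(g₁ + i g₂) = 1.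
  have e₁ : z.re • g₁ - i * g₁ - z.im • g₂ = 1 := by
    ext t
    have := congrArg Complex.re (hmul t)
    simp at this
    change z.re * g₁ t - t * g₁ t - z.im * g₂ t = 1
    linarith
  have e₂ : z.re • g₂ - i * g₂ + z.im • g₁ = 0 := by
    ext t
    have := congrArg Complex.im (hmul t)
    simp at this
    change z.re * g₂ t - t * g₂ t + z.im * g₁ t = 0
    linarith
  set C₁ := cfcHom hA g₁ with hC₁
  set C₂ := cfcHom hA g₂ with hC₂
  have f₁ : z.re • C₁ - A * C₁ - z.im • C₂ = 1 := by
    have := congrArg (cfcHom hA) e₁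
    simpa only [map_sub, map_smul, map_mul, hi, map_one] using this
  have f₂ : z.re • C₂ - A * C₂ + z.im • C₁ = 0 := by
    have := congrArg (cfcHom hA) e₂
    simpa only [map_sub, map_add, map_smul, map_mul, hi, map_zero] using this
  have c₁ : A * C₁ = C₁ * A := by
    have := congrArg (cfcHom hA) (mul_comm i g₁)
    simpa only [map_mul, hi] using this
  have c₂ : A * C₂ = C₂ * A := by
    have := congrArg (cfcHom hA) (mul_comm i g₂)
    simpa only [map_mul, hi] using this
  have hsm : ∀ (r : ℝ) (x : H), r • x = (r : ℂ) • x := fun r x => (Complex.coe_smul r x).symm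
  have key : ∀ v, z • (C₁ v + Complex.I • C₂ v) - (A (C₁ v) + Complex.I • A (C₂ v)) = v := by
    intro v
    have h₁ := congrArg (fun T : H →L[ℂ] H => T v) f₁
    have h₂ := congrArg (fun T : H →L[ℂ] H => T v) f₂
    simp only [sub_apply, add_apply, smul_apply, mul_apply_eq_comp,
      one_apply_eq_self, zero_apply, hsm] at h₁ h₂
    have h₃ : z • (C₁ v + Complex.I • C₂ v) - (A (C₁ v) + Complex.I • A (C₂ v)) =
        ((z.re : ℂ) • C₁ v - A (C₁ v) - (z.im : ℂ) • C₂ v) +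
          Complex.I • ((z.re : ℂ) • C₂ v - A (C₂ v) + (z.im : ℂ) • C₁ v) := by
      have hI : Complex.I * Complex.I = -1 := Complex.I_mul_I
      conv_lhs => rw [← Complex.re_add_im z]
      match_scalars <;> first | ring1 | linear_combination (z.im : ℂ) * hI
    rw [h₃, h₁, h₂, smul_zero, add_zero]
  refine ⟨C₁ + Complex.I • C₂, fun v => ?_, fun v => ?_, fun ψ => ?_⟩
  · simpa using key v
  · have k₁ : ∀ v, C₁ (A v) = A (C₁ v) := fun v =>
      congrArg (fun T : H →L[ℂ] H => T v) c₁.symm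
    have k₂ : ∀ v, C₂ (A v) = A (C₂ v) := fun v =>
      congrArg (fun T : H →L[ℂ] H => T v) c₂.symm
    refine Eq.trans ?_ (key v)
    simp only [add_apply, smul_apply, map_sub, map_smul, k₁, k₂]
  · rw [cauchyTransform_spectralMeasure_eq_integral]
    have hint : MeasureTheory.Integrable (fun t : spectrum ℝ A => 1 / (z - ((t : ℝ) : ℂ)))
        (RealRMK.rieszMeasure (spectralFunctional A hA ψ)) :=
      hcont.integrable_of_hasCompactSupport (HasCompactSupport.of_compactSpace _)
    have hs := integral_re_add_im (𝕜 := ℂ) hint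
    rw [← hs]
    have s₁ := spectralMeasure_integral A hA ψ g₁
    have s₂ := spectralMeasure_integral A hA ψ g₂
    have r₁ := inner_cfcHom_re A hA ψ g₁
    have r₂ := inner_cfcHom_re A hA ψ g₂
    change (((∫ t, g₁ t ∂_ : ℝ) : ℂ)) + ((∫ t, g₂ t ∂_ : ℝ) : ℂ) * Complex.I = _
    rw [s₁, s₂, r₁, r₂]
    simp only [add_apply, smul_apply, inner_add_right, inner_smul_right]
    ring

theorem cauchyTransform_spectralMeasure_ofReal (A : H →L[ℂ] H) (hA : IsSelfAdjoint A) (ψ : H)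
    (x : ℝ) :
    cauchyTransform (spectralMeasure A hA ψ) x =
      ((∫ t : spectrum ℝ A, 1 / (x - (t : ℝ))
        ∂(RealRMK.rieszMeasure (spectralFunctional A hA ψ)) : ℝ) : ℂ) := by
  rw [cauchyTransform_spectralMeasure_eq_integral, ← integral_complex_ofReal]
  push_cast
  rfl

/-- Outside the convex hull of the spectrum the Cauchy transform has constant sign `ε`. -/
theorem exists_sign_cauchyTransform (A : H →L[ℂ] H) (hA : IsSelfAdjoint A) {x : ℝ}
    (hx : x ∉ convexHull ℝ (spectrum ℝ A)) :
    ∃ ε : ℝ, ε ^ 2 = 1 ∧ ∀ ψ, ∃ c : ℝ, 0 ≤ c ∧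
      cauchyTransform (spectralMeasure A hA ψ) x = ((ε * c : ℝ) : ℂ) := by
  by_cases h : ∀ t ∈ spectrum ℝ A, t ≤ x
  · refine ⟨1, by norm_num, fun ψ => ⟨_, ?_,
      (cauchyTransform_spectralMeasure_ofReal A hA ψ x).trans (by rw [one_mul])⟩⟩
    exact MeasureTheory.integral_nonneg fun t => one_div_nonneg.2 (sub_nonneg.2 (h t t.2))
  · push Not at h
    obtain ⟨s, hs, hxs⟩ := h
    -- A spectral point below `x`, together with `s` above it, would put `x` in the convex hull.
    have h' : ∀ t ∈ spectrum ℝ A, x ≤ t := by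
      intro t ht
      by_contra! htx
      refine hx ((convex_convexHull ℝ _).ordConnected.out (subset_convexHull ℝ _ ht)
        (subset_convexHull ℝ _ hs) ⟨htx.le, hxs.le⟩)
    refine ⟨-1, by norm_num, fun ψ => ⟨-_, ?_,
      (cauchyTransform_spectralMeasure_ofReal A hA ψ x).trans (by rw [neg_one_mul, neg_neg])⟩⟩
    exact neg_nonneg.2 (MeasureTheory.integral_nonpos fun t =>
      one_div_nonpos.2 (sub_nonpos.2 (h' t t.2)))

end Resolvent

/-! ### The Green function on the universal cover. -/

namespace Graph

variable {α β : Type*} {G : Graph α β} {v₀ : α}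

theorem finite_dartFrom_of_finite (hV : V(G).Finite) (hE : E(G).Finite) (u : α) :
    Finite (G.DartFrom u) := by
  have := Dart.finite hE hV
  infer_instance

open Classical in
/-- How the Jacobi matrix of the universal cover acts on a function that is cut off on one side of
an edge. -/
theorem jacobiFun_indicator (hV : V(G).Finite) (hE : E(G).Finite) (a : β → ℝ) (b : α → ℝ)
    (f : V(G.universalCover v₀) → ℂ) (p : V(G.universalCover v₀))
    (d : G.DartFrom (walkEnd v₀ (p : List G.Dart))) {S : Set V(G.universalCover v₀)}
    (hp : p ∈ S) (hd : coverStep p d ∉ S)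
    (hS : ∀ q e, ¬ (q = p ∧ coverStep q e = coverStep p d) →
        ¬ (q = coverStep p d ∧ coverStep q e = p) → (coverStep q e ∈ S ↔ q ∈ S))
    (v : V(G.universalCover v₀)) :
    (G.universalCover v₀).jacobiFun (liftEdge a) (liftVertex v₀ b) (S.indicator f) v =
      S.indicator ((G.universalCover v₀).jacobiFun (liftEdge a) (liftVertex v₀ b) f) v
        - a d.1.edge * f (coverStep p d) * Pi.single (M := fun _ => ℂ) p 1 v
        + a d.1.edge * f p * Pi.single (M := fun _ => ℂ) (coverStep p d) 1 v := by
  have := finite_dartFrom_of_finite hV hE (walkEnd v₀ (v : List G.Dart))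
  have := Fintype.ofFinite (G.DartFrom (walkEnd v₀ (v : List G.Dart)))
  have hne : p ≠ coverStep p d := fun h => hd (h ▸ hp)
  rw [jacobiFun_universalCover, finsum_eq_sum_of_fintype]
  by_cases h1 : v = p
  · subst h1
    rw [Pi.single_eq_same, Pi.single_eq_of_ne hne, Set.indicator_of_mem hp,
      Set.indicator_of_mem hp, jacobiFun_universalCover, finsum_eq_sum_of_fintype]
    -- At the near end of the cut, truncation kills exactly one neighbour, the one along `d`.
    have h2 : ∑ e, (a e.1.edge : ℂ) * (f (coverStep v e) - S.indicator f (coverStep v e)) =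
        a d.1.edge * f (coverStep v d) := by
      rw [Finset.sum_eq_single d]
      · rw [Set.indicator_of_notMem hd, sub_zero]
      · intro e _ he
        have : coverStep v e ∈ S :=
          (hS v e (fun h => he (coverStep_injective v h.2)) (fun h => hne h.1)).2 hp
        rw [Set.indicator_of_mem this, sub_self, mul_zero]
      · exact fun h => absurd (Finset.mem_univ d) h
    simp only [mul_sub, Finset.sum_sub_distrib] at h2
    linear_combination -h2
  by_cases h2 : v = coverStep p d
  · subst h2
    rw [Pi.single_eq_same, Pi.single_eq_of_ne hne.symm, Set.indicator_of_notMem hd,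
      Set.indicator_of_notMem hd]
    -- The same edge seen from its far end: it leads to the only neighbour that lies in `S`.
    let d' : G.DartFrom (walkEnd v₀ (coverStep p d : List G.Dart)) :=
      ⟨d.1.rev, (walkEnd_coverStep p d).symm⟩
    have hd' : coverStep (coverStep p d) d' = p :=
      Subtype.ext (IsNonbacktracking.walkStep_walkStep_rev p.2 d.1)
    rw [Finset.sum_eq_single d', hd', Set.indicator_of_mem hp]
    · simp [d']
    · intro e _ he
      have : coverStep (coverStep p d) e ∉ S := fun h => hd
        ((hS _ e (fun h => h1 h.1)
          (fun h => he (coverStep_injective _ (h.2.trans hd'.symm)))).1 h)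
      rw [Set.indicator_of_notMem this, mul_zero]
    · exact fun h => absurd (Finset.mem_univ d') h
  · rw [Pi.single_eq_of_ne h1, Pi.single_eq_of_ne h2]
    have h3 : ∀ e, coverStep v e ∈ S ↔ v ∈ S := fun e =>
      hS v e (fun h => h1 h.1) (fun h => h2 h.1)
    by_cases hv : v ∈ S
    · rw [Set.indicator_of_mem hv, Set.indicator_of_mem hv, jacobiFun_universalCover,
        finsum_eq_sum_of_fintype, Finset.sum_congr rfl fun e _ => by
          rw [Set.indicator_of_mem ((h3 e).2 hv)]]
      ring
    · rw [Set.indicator_of_notMem hv, Set.indicator_of_notMem hv,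
        Finset.sum_eq_zero fun e _ => by
          rw [Set.indicator_of_notMem (fun h => hv ((h3 e).1 h)), mul_zero]]
      ring

section Green

variable (hV : V(G).Finite) (hE : E(G).Finite) (a : β → ℝ) (b : α → ℝ) {z : ℂ}
  {R : lp (fun _ : V(G.universalCover v₀) => ℂ) 2 →L[ℂ]
    lp (fun _ : V(G.universalCover v₀) => ℂ) 2}

-- Let a deck map carry `p` to `q`. Composing R δ_q with it gives a solution of (z - A)g = δ_p,
-- square summable since the deck map is injective. Applying R identifies it with R δ_p.
open Classical in
theorem green_comp_deck (hR : ∀ v, z • R v - G.coverOperator hV hE a b v₀ (R v) = v)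
    (hR' : ∀ v, R (z • v - G.coverOperator hV hE a b v₀ v) = v) {p q : V(G.universalCover v₀)}
    (h : walkEnd v₀ (p : List G.Dart) = walkEnd v₀ (q : List G.Dart)) :
    R (lp.single 2 p 1) p = R (lp.single 2 q 1) q := by
  obtain ⟨x, hx, hc, hpq⟩ := exists_walkConcat_eq p.2 q.2 h
  have hF : deckMap hx hc p = q := Subtype.ext hpq
  have hinj := deckMap_injective hx hc
  set f := R (lp.single 2 q 1) with hf
  have hmem : Memℓp (f ∘ deckMap hx hc) 2 := by
    refine memℓp_gen ?_
    have := (summable_sq f).comp_injective hinj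
    simpa [Function.comp_def] using this
  let g : lp (fun _ : V(G.universalCover v₀) => ℂ) 2 := ⟨f ∘ deckMap hx hc, hmem⟩
  have hg : z • g - G.coverOperator hV hE a b v₀ g = lp.single 2 p 1 := by
    ext y
    have h1 := congrArg (fun k : lp (fun _ : V(G.universalCover v₀) => ℂ) 2 => k (deckMap hx hc y))
      (hR (lp.single 2 q 1))
    change z * f (deckMap hx hc y) - (G.universalCover v₀).jacobiFun (liftEdge a)
      (liftVertex v₀ b) (f ∘ deckMap hx hc) y = Pi.single (M := fun _ => ℂ) p 1 y
    change z * f (deckMap hx hc y) - (G.universalCover v₀).jacobiFun (liftEdge a)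
      (liftVertex v₀ b) f (deckMap hx hc y) =
        Pi.single (M := fun _ => ℂ) q 1 (deckMap hx hc y) at h1
    rw [jacobiFun_comp_deckMap, h1, ← hF]
    by_cases hy : y = p
    · rw [hy, Pi.single_eq_same, Pi.single_eq_same]
    · rw [Pi.single_eq_of_ne hy, Pi.single_eq_of_ne fun h => hy (hinj h)]
  have h2 := hR' g
  rw [hg] at h2
  rw [h2, ← hF]
  rfl

open Classical in
/-- The resolvent of a Jacobi matrix on a tree at the two ends of an edge. -/
theorem green_edge (hR : ∀ v, z • R v - G.coverOperator hV hE a b v₀ (R v) = v)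
    (hR' : ∀ v, R (z • v - G.coverOperator hV hE a b v₀ v) = v) (p : V(G.universalCover v₀))
    (d : G.DartFrom (walkEnd v₀ (p : List G.Dart))) :
    R (lp.single 2 p 1) (coverStep p d) =
      a d.1.edge * (R (lp.single 2 p 1) p * R (lp.single 2 (coverStep p d) 1) (coverStep p d)
        - R (lp.single 2 p 1) (coverStep p d) ^ 2) := by
  obtain ⟨S, hp, hd, hS⟩ := exists_cut p d
  set f := R (lp.single 2 p 1) with hf
  have hmem : Memℓp (S.indicator f) 2 := by
    refine memℓp_gen ?_
    have := Summable.of_nonneg_of_le (fun v => sq_nonneg ‖S.indicator f v‖) (fun v => by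
      gcongr
      exact norm_indicator_le_norm_self _ _) (summable_sq f)
    simpa using this
  let g : lp (fun _ : V(G.universalCover v₀) => ℂ) 2 := ⟨S.indicator f, hmem⟩
  -- The truncated function solves the resolvent equation up to sources at the two ends of the cut
  -- edge.
  have hg : z • g - G.coverOperator hV hE a b v₀ g =
      (1 + a d.1.edge * f (coverStep p d)) • lp.single 2 p (1 : ℂ)
        - ((a d.1.edge : ℂ) * f p) • lp.single 2 (coverStep p d) (1 : ℂ) := by
    ext y
    have h1 := congrArg (fun k : lp (fun _ : V(G.universalCover v₀) => ℂ) 2 => k y)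
      (hR (lp.single 2 p 1))
    change z * f y - (G.universalCover v₀).jacobiFun (liftEdge a) (liftVertex v₀ b) f y =
        Pi.single (M := fun _ => ℂ) p 1 y at h1
    change z * S.indicator f y - (G.universalCover v₀).jacobiFun (liftEdge a) (liftVertex v₀ b)
        (S.indicator f) y =
      (1 + a d.1.edge * f (coverStep p d)) * Pi.single (M := fun _ => ℂ) p 1 y
        - ((a d.1.edge : ℂ) * f p) * Pi.single (M := fun _ => ℂ) (coverStep p d) 1 y
    rw [jacobiFun_indicator hV hE a b f p d hp hd hS y]
    by_cases hy : y ∈ S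
    · rw [Set.indicator_of_mem hy, Set.indicator_of_mem hy]
      linear_combination h1
    · rw [Set.indicator_of_notMem hy, Set.indicator_of_notMem hy,
        Pi.single_eq_of_ne (fun h => hy (by rw [h]; exact hp))]
      ring
  have h2 := hR' g
  rw [hg, map_sub, map_smul, map_smul] at h2
  -- At the far end the truncated function vanishes, which leaves the quadratic relation.
  have h3 := congrArg (fun k : lp (fun _ : V(G.universalCover v₀) => ℂ) 2 => k (coverStep p d)) h2
  change (1 + a d.1.edge * f (coverStep p d)) * f (coverStep p d) -
    ((a d.1.edge : ℂ) * f p) * R (lp.single 2 (coverStep p d) 1) (coverStep p d) =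
      S.indicator f (coverStep p d) at h3
  rw [Set.indicator_of_notMem hd] at h3
  linear_combination h3

open Classical in
theorem green_vertex (hR : ∀ v, z • R v - G.coverOperator hV hE a b v₀ (R v) = v)
    (p : V(G.universalCover v₀)) :
    (z - b (walkEnd v₀ (p : List G.Dart))) * R (lp.single 2 p 1) p =
      1 + ∑ᶠ d : G.DartFrom (walkEnd v₀ (p : List G.Dart)),
        (a d.1.edge : ℂ) * R (lp.single 2 p 1) (coverStep p d) := by
  have h1 := congrArg (fun k : lp (fun _ : V(G.universalCover v₀) => ℂ) 2 => k p)
    (hR (lp.single 2 p 1))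
  change z * R (lp.single 2 p 1) p - (G.universalCover v₀).jacobiFun (liftEdge a)
    (liftVertex v₀ b) (R (lp.single 2 p 1)) p = Pi.single (M := fun _ => ℂ) p 1 p at h1
  rw [jacobiFun_universalCover, Pi.single_eq_same] at h1
  linear_combination h1

-- `green_edge` completes the square, and the hypothesis puts 1 + 2ag in the open right half-plane,
-- where the principal root undoes squaring.
open Classical in
theorem sqrt_green_edge (hR : ∀ v, z • R v - G.coverOperator hV hE a b v₀ (R v) = v)
    (hR' : ∀ v, R (z • v - G.coverOperator hV hE a b v₀ v) = v) (p : V(G.universalCover v₀))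
    (d : G.DartFrom (walkEnd v₀ (p : List G.Dart)))
    (hpos : -(1 / 2) < ((a d.1.edge : ℂ) * R (lp.single 2 p 1) (coverStep p d)).re) :
    Complex.sqrt (1 + 4 * (a d.1.edge : ℂ) ^ 2 * R (lp.single 2 p 1) p *
        R (lp.single 2 (coverStep p d) 1) (coverStep p d)) =
      1 + 2 * (a d.1.edge * R (lp.single 2 p 1) (coverStep p d)) := by
  have h := green_edge hV hE a b hR hR' p d
  have h1 : 1 + 4 * (a d.1.edge : ℂ) ^ 2 * R (lp.single 2 p 1) p *
        R (lp.single 2 (coverStep p d) 1) (coverStep p d) =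
      (1 + 2 * (a d.1.edge * R (lp.single 2 p 1) (coverStep p d))) ^ 2 := by
    linear_combination -4 * (a d.1.edge : ℂ) * h
  rw [h1, Complex.sqrt]
  refine Complex.sq_cpow_two_inv ?_
  rw [Complex.add_re, Complex.one_re, two_mul, Complex.add_re]
  linarith

open Classical in
theorem aomoto_equation_of_green (hR : ∀ v, z • R v - G.coverOperator hV hE a b v₀ (R v) = v)
    (hR' : ∀ v, R (z • v - G.coverOperator hV hE a b v₀ v) = v)
    (p : V(G.universalCover v₀)) (u : V(G)) (hp : walkEnd v₀ (p : List G.Dart) = u)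
    (hz : z ≠ b u) {w : V(G) → ℂ} (hw : w u = R (lp.single 2 p 1) p)
    (hs : ∀ d : G.DartFrom (walkEnd v₀ (p : List G.Dart)),
      w ⟨d.1.tgt, d.1.isLink.right_mem⟩ = R (lp.single 2 (coverStep p d) 1) (coverStep p d))
    (hpos : ∀ d : G.DartFrom (walkEnd v₀ (p : List G.Dart)),
      -(1 / 2) < ((a d.1.edge : ℂ) * R (lp.single 2 p 1) (coverStep p d)).re) :
    w u = 1 / (2 * (z - (b u : ℂ))) *
    (2 - (G.degree u : ℂ)
      + (∑ᶠ p : G.Spoke u, Complex.sqrt (1 + 4 * (a p.1.1 : ℂ) ^ 2 * w u * w p.1.2))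
      + ∑ᶠ l : G.loopSet u, 2 * Complex.sqrt (1 + 4 * (a l : ℂ) ^ 2 * w u ^ 2)) := by
  obtain ⟨u, hu⟩ := u
  change walkEnd v₀ (p : List G.Dart) = u at hp
  subst hp
  have := finite_dartFrom_of_finite hV hE (walkEnd v₀ (p : List G.Dart))
  have := Fintype.ofFinite (G.DartFrom (walkEnd v₀ (p : List G.Dart)))
  set u : V(G) := ⟨walkEnd v₀ (p : List G.Dart), hu⟩ with hu_def
  have h1 := finsum_dartFrom hE u
    (fun e v => Complex.sqrt (1 + 4 * (a e : ℂ) ^ 2 * w u * w v))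
  have h2 : ∑ᶠ d : G.DartFrom (u : α), Complex.sqrt (1 + 4 * (a d.1.edge : ℂ) ^ 2 * w u *
      w ⟨d.1.tgt, d.1.isLink.right_mem⟩) = ∑ᶠ d : G.DartFrom (walkEnd v₀ (p : List G.Dart)),
        (1 + 2 * ((a d.1.edge : ℂ) * R (lp.single 2 p 1) (coverStep p d))) :=
    finsum_congr fun d => by
      rw [hw, ← sqrt_green_edge hV hE a b hR hR' p d (hpos d), hs d]
  have h3 := green_vertex hV hE a b hR p
  have h4 : (G.degree (u : α) : ℂ) =
      Fintype.card (G.DartFrom (walkEnd v₀ (p : List G.Dart))) := by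
    rw [degree_eq_card_dartFrom hE u, Nat.card_eq_fintype_card]
  have h5 : ∑ᶠ l : G.loopSet (u : α), 2 * Complex.sqrt (1 + 4 * (a l : ℂ) ^ 2 * w u ^ 2) =
      ∑ᶠ l : G.loopSet (u : α), 2 * Complex.sqrt (1 + 4 * (a l : ℂ) ^ 2 * w u * w u) :=
    finsum_congr fun l => by rw [pow_two (w u), ← mul_assoc]
  rw [h2, finsum_eq_sum_of_fintype, Finset.sum_add_distrib, ← Finset.mul_sum] at h1
  rw [finsum_eq_sum_of_fintype] at h3
  rw [add_assoc, h5, ← h1, h4, Finset.sum_const, Finset.card_univ, nsmul_eq_mul, mul_one]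
  have hz' : z - (b u : ℂ) ≠ 0 := sub_ne_zero.2 hz
  rw [← hw] at h3
  rw [one_div, eq_inv_mul_iff_mul_eq₀ (mul_ne_zero two_ne_zero hz')]
  linear_combination 2 * h3

open Classical in
theorem aomotoSystem_of_resolvent (hR : ∀ v, z • R v - G.coverOperator hV hE a b v₀ (R v) = v)
    (hR' : ∀ v, R (z • v - G.coverOperator hV hE a b v₀ v) = v)
    (hC : ∀ ψ, cauchyTransform (spectralMeasure (G.coverOperator hV hE a b v₀)
      (G.coverOperator_isSelfAdjoint hV hE a b v₀) ψ) z = inner ℂ ψ (R ψ))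
    (hz : ∀ u : V(G), z ≠ b u)
    (hpos : ∀ (p : V(G.universalCover v₀)) (d : G.DartFrom (walkEnd v₀ (p : List G.Dart))),
      -(1 / 2) < ((a d.1.edge : ℂ) * R (lp.single 2 p 1) (coverStep p d)).re)
    (r : V(G) → V(G.universalCover v₀))
    (hr : ∀ u : V(G), walkEnd v₀ (r u : List G.Dart) = u) :
    G.AomotoSystem a b z (fun u => G.coverCauchy hV hE a b v₀ (r u) z) := by
  have hw : ∀ p, G.coverCauchy hV hE a b v₀ p z = R (lp.single 2 p 1) p := by
    intro p
    rw [coverCauchy, hC, lp.inner_single_left]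
    simp
  intro u
  refine aomoto_equation_of_green hV hE a b hR hR' (r u) u (hr u) (hz u)
    (w := fun u => G.coverCauchy hV hE a b v₀ (r u) z) (hw (r u)) (fun d => ?_) (hpos (r u))
  rw [hw]
  -- The neighbour of `r u` along `d` need not be the chosen lift of its end; deck invariance makes
  -- the two diagonal entries equal.
  exact green_comp_deck hV hE a b hR hR' ((hr _).trans (walkEnd_coverStep _ d).symm)

/-! ### Bounds that select the principal branch. -/

theorem re_nonneg_of_eq_mul_sub_sq {a P Q : ℝ} {g : ℂ} (h : g = a * ((P : ℂ) * Q - g ^ 2))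
    (hPQ : g.re ^ 2 ≤ P * Q) : 0 ≤ ((a : ℂ) * g).re := by
  have h1 := congrArg Complex.re h
  simp [pow_two] at h1
  -- The imaginary part of `g` contributes with the favourable sign, so `g` need not be known to be
  -- real.
  have h2 : a * g.re = a ^ 2 * (P * Q - g.re ^ 2) + (a * g.im) ^ 2 := by
    linear_combination a * h1
  rw [Complex.re_ofReal_mul, h2]
  exact add_nonneg (mul_nonneg (sq_nonneg a) (sub_nonneg.2 hPQ)) (sq_nonneg _)

-- The form of εR is nonnegative, so Cauchy–Schwarz for δ_p and δ_q bounds (Re g)² by PQ; the edge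
-- identity then gives the sign.
open Classical in
theorem green_edge_re_nonneg (hR : ∀ v, z • R v - G.coverOperator hV hE a b v₀ (R v) = v)
    (hR' : ∀ v, R (z • v - G.coverOperator hV hE a b v₀ v) = v) {ε : ℝ} (hε : ε ^ 2 = 1)
    (hpos : ∀ ψ, ∃ c : ℝ, 0 ≤ c ∧ inner ℂ ψ (R ψ) = ((ε * c : ℝ) : ℂ))
    (p : V(G.universalCover v₀)) (d : G.DartFrom (walkEnd v₀ (p : List G.Dart))) :
    0 ≤ ((a d.1.edge : ℂ) * R (lp.single 2 p 1) (coverStep p d)).re := by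
  set q := coverStep p d with hq
  set x := lp.single (E := fun _ : V(G.universalCover v₀) => ℂ) 2 p 1 with hx
  set y := lp.single (E := fun _ : V(G.universalCover v₀) => ℂ) 2 q 1 with hy
  have hxi : ∀ f, inner ℂ x f = f p := fun f => by rw [hx, lp.inner_single_left]; simp
  have hyi : ∀ f, inner ℂ y f = f q := fun f => by rw [hy, lp.inner_single_left]; simp
  obtain ⟨P, hP, hP'⟩ := hpos x
  obtain ⟨Q, hQ, hQ'⟩ := hpos y
  have hform : ∀ c : ℂ, inner ℂ (x + c • y) (R (x + c • y)) =
      inner ℂ x (R x) + c * inner ℂ x (R y) + starRingEnd ℂ c * inner ℂ y (R x) +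
        starRingEnd ℂ c * c * inner ℂ y (R y) := by
    intro c
    simp only [map_add, map_smul, inner_add_left, inner_add_right, inner_smul_left,
      inner_smul_right]
    ring
  -- The form takes only real values; its value at δ_p + iδ_q gives the symmetry of the real parts.
  have hsym : (R y p).re = (R x q).re := by
    obtain ⟨c, -, hc⟩ := hpos (x + Complex.I • y)
    have := congrArg Complex.im ((hform Complex.I).symm.trans hc)
    rw [hP', hQ', hxi, hyi] at this
    simp at this
    linarith
  -- This is ε times the form at δ_p + tδ_q, with ε² = 1; nonnegativity for all real `t` bounds the
  -- discriminant.
  have hdisc : ∀ t : ℝ, 0 ≤ Q * (t * t) + (2 * ε * (R x q).re) * t + P := by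
    intro t
    obtain ⟨c, hc0, hc⟩ := hpos (x + (t : ℂ) • y)
    have := congrArg Complex.re ((hform t).symm.trans hc)
    rw [hP', hQ', hxi, hyi] at this
    simp [hsym] at this
    have h1 : Q * (t * t) + (2 * ε * (R x q).re) * t + P = c := by
      linear_combination ε * this + (c - P - t * t * Q) * hε
    rw [h1]
    exact hc0
  have hPQ := discrim_le_zero hdisc
  rw [discrim] at hPQ
  have hPQ' : (R x q).re ^ 2 ≤ (ε * P) * (ε * Q) := by
    have h1 : (2 * ε * (R x q).re) ^ 2 = 4 * (R x q).re ^ 2 := by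
      linear_combination 4 * (R x q).re ^ 2 * hε
    have h2 : (ε * P) * (ε * Q) = P * Q := by linear_combination P * Q * hε
    rw [h2]
    linarith
  refine re_nonneg_of_eq_mul_sub_sq ?_ hPQ'
  rw [← hP', ← hQ', hxi, hyi]
  exact green_edge hV hE a b hR hR' p d

-- At z = b the vertex equation would have real part 0 = 1 + (a sum of nonnegative terms).
open Classical in
theorem ne_coeff_of_green_edge_re_nonneg (hR : ∀ v, z • R v - G.coverOperator hV hE a b v₀ (R v) = v)
    (p : V(G.universalCover v₀))
    (hpos : ∀ d : G.DartFrom (walkEnd v₀ (p : List G.Dart)),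
      0 ≤ ((a d.1.edge : ℂ) * R (lp.single 2 p 1) (coverStep p d)).re) :
    z ≠ b (walkEnd v₀ (p : List G.Dart)) := by
  intro h
  have := finite_dartFrom_of_finite hV hE (walkEnd v₀ (p : List G.Dart))
  have := Fintype.ofFinite (G.DartFrom (walkEnd v₀ (p : List G.Dart)))
  have h1 := green_vertex hV hE a b hR p
  rw [← h, sub_self, zero_mul, finsum_eq_sum_of_fintype] at h1
  have h2 := congrArg Complex.re h1
  rw [Complex.add_re, Complex.re_sum, Complex.one_re, Complex.zero_re] at h2
  have h3 := Finset.sum_nonneg fun d (_ : d ∈ Finset.univ) => hpos d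
  linarith

-- From z R δ_p = δ_p + A R δ_p one gets (‖z‖ - ‖A‖)‖R δ_p‖ ≤ 1, and ‖z‖ - ‖A‖ > 2C makes C‖R δ_p‖ <
-- 1/2.
open Classical in
theorem neg_half_lt_green_edge_re
    (hR : ∀ v, z • R v - G.coverOperator hV hE a b v₀ (R v) = v) {C : ℝ}
    (hC : ∀ e ∈ E(G), |a e| ≤ C) (hz : ‖G.coverOperator hV hE a b v₀‖ + 2 * C < ‖z‖)
    (p : V(G.universalCover v₀)) (d : G.DartFrom (walkEnd v₀ (p : List G.Dart))) :
    -(1 / 2) < ((a d.1.edge : ℂ) * R (lp.single 2 p 1) (coverStep p d)).re := by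
  set A := G.coverOperator hV hE a b v₀
  set x := lp.single (E := fun _ : V(G.universalCover v₀) => ℂ) 2 p 1 with hx
  have hx1 : ‖x‖ = 1 := by rw [hx, lp.norm_single (by norm_num), norm_one]
  have h1 : ‖z‖ * ‖R x‖ ≤ 1 + ‖A‖ * ‖R x‖ := by
    rw [← norm_smul, ← hx1, sub_eq_iff_eq_add.1 (hR x)]
    refine (norm_add_le _ _).trans ?_
    gcongr
    exact A.le_opNorm _
  have h2 : ‖R x (coverStep p d)‖ ≤ ‖R x‖ := lp.norm_apply_le_norm (by norm_num) _ _
  have hC' := hC _ d.1.isLink.edge_mem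
  have h3 : ‖(a d.1.edge : ℂ) * R x (coverStep p d)‖ ≤ C * ‖R x‖ := by
    rw [norm_mul, Complex.norm_real, Real.norm_eq_abs]
    exact mul_le_mul hC' h2 (norm_nonneg _) ((abs_nonneg _).trans hC')
  have h4 : C * ‖R x‖ < 1 / 2 := by
    rcases (norm_nonneg (R x)).eq_or_lt with h0 | h0
    · rw [← h0]
      norm_num
    · nlinarith [mul_lt_mul_of_pos_right hz h0]
  have h5 := (Complex.abs_re_le_norm _).trans_lt (h3.trans_lt h4)
  exact (abs_lt.1 h5).1

end Green

end Graph

/-! ### Conclusion in the two regions. -/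

theorem norm_le_of_mem_spectrum_real {H : Type*} [NormedAddCommGroup H] [InnerProductSpace ℂ H]
    [CompleteSpace H] (A : H →L[ℂ] H) {t : ℝ} (ht : t ∈ spectrum ℝ A) : ‖t‖ ≤ ‖A‖ :=
  (spectrum.norm_le_norm_mul_of_mem ht).trans
    (mul_le_of_le_one_right (norm_nonneg _) ContinuousLinearMap.norm_id_le)

theorem theorem1p2 {α β : Type*} (G : Graph α β) (hV : V(G).Finite) (hE : E(G).Finite)
    (hG : G.IsConnected) (a : β → ℝ) (b : α → ℝ) (ha : ∀ e ∈ E(G), a e ≠ 0)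
    (v₀ : α) (hv₀ : v₀ ∈ V(G)) :
    (∀ᶠ z : ℂ in Bornology.cobounded ℂ,
      ∀ r : V(G) → V(G.universalCover v₀),
        (∀ u : V(G), Graph.walkEnd v₀ (r u : List G.Dart) = u) →
          G.AomotoSystem a b z (fun u => G.coverCauchy hV hE a b v₀ (r u) z)) ∧
    (∀ x : ℝ, x ∉ convexHull ℝ (spectrum ℝ (G.coverOperator hV hE a b v₀)) →
      ∀ r : V(G) → V(G.universalCover v₀),
        (∀ u : V(G), Graph.walkEnd v₀ (r u : List G.Dart) = u) →
          G.AomotoSystem a b (x : ℂ) (fun u => G.coverCauchy hV hE a b v₀ (r u) (x : ℂ))) := by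
  set A := G.coverOperator hV hE a b v₀ with hA
  have hsa := G.coverOperator_isSelfAdjoint hV hE a b v₀
  refine ⟨?_, fun x hx r hr => ?_⟩
  · obtain ⟨C, hC⟩ := (hE.image fun e => |a e|).bddAbove
    obtain ⟨B, hB⟩ := (hV.image fun u => |b u|).bddAbove
    -- If there are no edges, the upper bound `C` may be negative; with |C| the threshold below
    -- still exceeds ‖A‖.
    have hC' : ∀ e ∈ E(G), |a e| ≤ |C| := fun e he =>
      (hC (Set.mem_image_of_mem _ he)).trans (le_abs_self C)
    -- The first threshold keeps `z` off the spectrum and fixes the branch, the second keeps `z`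
    -- away from every `b u`. Neither involves the lifts `r`.
    filter_upwards [tendsto_norm_cobounded_atTop.eventually_gt_atTop (‖A‖ + 2 * |C|),
      tendsto_norm_cobounded_atTop.eventually_gt_atTop B] with z hz hzB r hr
    have hspec : ∀ t ∈ spectrum ℝ A, z ≠ (t : ℂ) := by
      rintro t ht rfl
      have h1 := norm_le_of_mem_spectrum_real A ht
      rw [Complex.norm_real] at hz
      linarith [abs_nonneg C]
    obtain ⟨R, hR, hR', hRC⟩ := exists_resolvent A hsa z hspec
    refine Graph.aomotoSystem_of_resolvent hV hE a b hR hR' hRC ?_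
      (Graph.neg_half_lt_green_edge_re hV hE a b hR hC' hz) r hr
    rintro u rfl
    rw [Complex.norm_real, Real.norm_eq_abs] at hzB
    exact hzB.not_ge (hB (Set.mem_image_of_mem _ u.2))
  · have hspec : ∀ t ∈ spectrum ℝ A, (x : ℂ) ≠ (t : ℂ) := by
      intro t ht h
      rw [Complex.ofReal_inj.1 h] at hx
      exact hx (subset_convexHull ℝ _ ht)
    obtain ⟨R, hR, hR', hRC⟩ := exists_resolvent A hsa x hspec
    obtain ⟨ε, hε, hsign⟩ := exists_sign_cauchyTransform A hsa hx
    have hpos := Graph.green_edge_re_nonneg hV hE a b hR hR' hε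
      fun ψ => by simpa only [hRC] using hsign ψ
    refine Graph.aomotoSystem_of_resolvent hV hE a b hR hR' hRC (fun u => ?_)
      (fun p d => lt_of_lt_of_le (by norm_num) (hpos p d)) r hr
    have := Graph.ne_coeff_of_green_edge_re_nonneg hV hE a b hR (r u) (hpos (r u))
    rwa [hr u] at this
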